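/- Let $R$ be the root system $C_n$ or $BC_n$ in $\mathbb{R}^n$ with its standard inner product: the positive roots $R^+$ are $\varepsilon_i\pm\varepsilon_j$ ($i<j$), $2\varepsilon_i$ and, for $BC_n$ only, also $\varepsilon_i$. Let $W$ be the Weyl group (all signed permutations of the coordinates), $L$ the weight lattice $\{\lambda:\langle\lambda,\alpha^\vee\rangle\in\mathbb{Z}\ \forall\alpha\in R\}$, $L^+$ the dominant weights $\{\lambda:\langle\lambda,\alpha^\vee\rangle\in\mathbb{Z}_{\ge 0}\ \forall\alpha\in R^+\}$, and $C=\{x:\langle x,\alpha\rangle\ge 0\ \forall \alpha\in R^+\}$ the fundamental Weyl chamber. For $w\in W$ put $R(w)=R^+\cap -wR^+$. Let $q\in\mathbb{C}$ with $0<|q|<1$, write $(x)_\infty=\prod_{k\ge 0}(1-xq^k)$, and let real powers of $q$ be defined by the principal logarithm. Let $u_\alpha$ ($\alpha\in R^+$) be complex numbers, let $u_{2\alpha}^{1/2}$ be a fixed square root of $u_{2\alpha}$ when $2\alpha$ is a root, and let $u_{2\alpha}^{1/2}=1$ when $2\alpha$ is not a root. Put $$\Delta(\zeta)=\prod_{\alpha\in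 R^+}\frac{(u_{2\alpha}^{1/2}u_\alpha q^{\langle\alpha,\zeta\rangle})_\infty}{(u_{2\alpha}^{1/2}q^{\langle\alpha,\zeta\rangle})_\infty}\,\frac{(q\,u_{2\alpha}^{1/2}q^{\langle\alpha,\zeta\rangle})_\infty}{(q\,u_{2\alpha}^{1/2}u_\alpha q^{\langle\alpha,\zeta\rangle})_\infty}\qquad(\zeta\in\mathbb{R}^n),$$ where removable singularities are removed; that is, at a point where a denominator vanishes, $\Delta$ takes its limit along the points where no denominator vanishes, if this limit exists in $\mathbb{C}$. Let $f$ be a complex-valued function on a $W$-invariant subset $D\subseteq\mathbb{R}^n$ with $f(w\zeta)=f(\zeta)$ for all $w\in W$, $\zeta\in D$. Let $z\in\mathbb{R}^n$ be such that $L$ is invariant under the Weyl group centered at $-z$: for all $w\in W$ and $\mu\in L$ there is a unique $\lambda\in L$ with $\mu=w(z+\lambda)-z$. Write $w\cdot\lambda=w(z+\lambda)-z$. Suppose that $C\subseteq C_z:=C-z$, that $z+\mu\in D$ for all $\mu\in L^+$, and that $\sum_{\mu\in L^+}f(z+\mu)$ converges absolutely. Define the overlap and the gap by $$P=\{\lambda\in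 L:\lambda\in w\cdot L^+\cap w'\cdot L^+\text{ for some }w\ne w'\text{ in }W\},\qquad Q=L\setminus\bigcup_{w\in W}w\cdot L^+ .$$ Let $g$ be a complex-valued function on $z+L$ such that $g(z+\mu)=f(z+\mu)\,\Delta(z+\mu)$ for every $\mu\in L$ at which $z+\mu\in D$ and $\Delta(z+\mu)$ is defined (elsewhere $g$ may take any values). Suppose that the sums of $g$ over $Q$ and over $P$ converge absolutely and satisfy $$\sum_{\mu\in Q}g(z+\mu)=0,\qquad \Big(\sum_{w\in W}\prod_{\alpha\in R(w)}u_\alpha\Big)\sum_{\mu\in P\cap L^+}f(z+\mu)=\sum_{\mu\in P}g(z+\mu).$$ Then $\sum_{\mu\in L}g(z+\mu)$ converges absolutely and $$\Big(\sum_{w\in W}\prod_{\alpha\in R(w)}u_\alpha\Big)\sum_{\mu\in L^+}f(z+\mu)=\sum_{\mu\in L}g(z+\mu).$$ -/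

import Mathlib

open Filter Topology

namespace Multilateral

/-- Which of the two root systems of rank `n` is considered: the reduced system `C_n` or the
non-reduced system `BC_n`. -/
inductive RootType
  | C
  | BC

/-- The Euclidean space in which the root systems live. -/
abbrev E (n : ℕ) := EuclideanSpace ℝ (Fin n)

/-- The standard basis vector `ε_i`. -/
noncomputable def eps {n : ℕ} (i : Fin n) : E n := EuclideanSpace.single i (1 : ℝ)

open Classical in
/-- The positive roots: `ε_i - ε_j` and `ε_i + ε_j` for `i < j`, the long roots `2 ε_i`, and for
`BC_n` also the short roots `ε_i`. -/
noncomputable def posRoots (n : ℕ) (T : RootType) : Finset (E n) :=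
  ((Finset.univ.filter fun p : Fin n × Fin n => p.1 < p.2).image fun p => eps p.1 - eps p.2) ∪
  ((Finset.univ.filter fun p : Fin n × Fin n => p.1 < p.2).image fun p => eps p.1 + eps p.2) ∪
  (Finset.univ.image fun i : Fin n => (2 : ℝ) • eps i) ∪
  (match T with
    | RootType.C => ∅
    | RootType.BC => Finset.univ.image fun i : Fin n => eps i)

/-- The root system `R = R⁺ ∪ -R⁺`. -/
def roots (n : ℕ) (T : RootType) : Set (E n) :=
  {α | α ∈ posRoots n T ∨ -α ∈ posRoots n T}

/-- The coroot `α^∨ = 2 α / ⟨α, α⟩`. -/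
noncomputable def coroot {n : ℕ} (α : E n) : E n := (2 / inner ℝ α α) • α

/-- The Weyl group of `C_n` and of `BC_n`: the hyperoctahedral group of the `2^n n!` signed
permutations `(σ, s)` of the coordinates. -/
abbrev Weyl (n : ℕ) := Equiv.Perm (Fin n) × (Fin n → ℤˣ)

/-- The standard action of the Weyl group by permuting and changing signs of coordinates:
`ε_i` is sent to `± ε_{σ i}`. -/
noncomputable def act {n : ℕ} (w : Weyl n) (x : E n) : E n :=
  WithLp.toLp 2 fun i => ((w.2 i : ℤ) : ℝ) * x (w.1.symm i)

open Classical in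
/-- `R(w) = R⁺ ∩ -w R⁺`. -/
noncomputable def invRoots {n : ℕ} (T : RootType) (w : Weyl n) : Finset (E n) :=
  posRoots n T ∩ (posRoots n T).image fun α => -act w α

/-- The weight lattice `L`. -/
def weightLattice (n : ℕ) (T : RootType) : Set (E n) :=
  {μ | ∀ α ∈ roots n T, ∃ k : ℤ, inner ℝ μ (coroot α) = (k : ℝ)}

/-- The dominant weights `L⁺`. -/
def dominantWeights (n : ℕ) (T : RootType) : Set (E n) :=
  {μ | ∀ α ∈ posRoots n T, ∃ k : ℕ, inner ℝ μ (coroot α) = (k : ℝ)}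

/-- The (closed) fundamental Weyl chamber `C`. -/
def chamber (n : ℕ) (T : RootType) : Set (E n) :=
  {x | ∀ α ∈ posRoots n T, 0 ≤ inner ℝ x α}

/-- The fundamental chamber `C_z`, obtained by translating `C` by `-z`. -/
def chamberAt {n : ℕ} (T : RootType) (z : E n) : Set (E n) :=
  (fun x => x - z) '' chamber n T

/-- The action of the Weyl group of the root system translated to the center `-z`. -/
noncomputable def actAt {n : ℕ} (z : E n) (w : Weyl n) (μ : E n) : E n :=
  act w (z + μ) - z

/-- The weight lattice `L` is invariant under the Weyl group centered at `-z`. -/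
def LatticeInvariant {n : ℕ} (T : RootType) (z : E n) : Prop :=
  ∀ w : Weyl n, ∀ μ ∈ weightLattice n T, ∃! l, l ∈ weightLattice n T ∧ μ = actAt z w l

/-- The overlap `P`: weights lying in the images of `L⁺` under two different elements of the Weyl
group centered at `-z`. -/
def overlap {n : ℕ} (T : RootType) (z : E n) : Set (E n) :=
  {μ | μ ∈ weightLattice n T ∧ ∃ w w' : Weyl n, w ≠ w' ∧
    μ ∈ actAt z w '' dominantWeights n T ∧ μ ∈ actAt z w' '' dominantWeights n T}

/-- The gap `Q`: weights lying in no image of `L⁺` under the Weyl group centered at `-z`. -/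
def gap {n : ℕ} (T : RootType) (z : E n) : Set (E n) :=
  weightLattice n T \ ⋃ w : Weyl n, actAt z w '' dominantWeights n T

/-- The infinite `q`-Pochhammer symbol `(x)_∞ = ∏_{k ≥ 0} (1 - x q^k)`. -/
noncomputable def qInf (q x : ℂ) : ℂ := ∏' k : ℕ, (1 - x * q ^ k)

/-- `q ^ ⟨α, ζ⟩`. -/
noncomputable def qexp {n : ℕ} (q : ℂ) (α ζ : E n) : ℂ := q ^ ((inner ℝ α ζ : ℝ) : ℂ)

/-- The product over the positive roots of the factors of Macdonald's identity, evaluated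
literally (it is meaningful where no denominator vanishes); `v α` stands for `u_{2α}^{1/2}`. -/
noncomputable def macProd {n : ℕ} (T : RootType) (q : ℂ) (u v : E n → ℂ) (ζ : E n) : ℂ :=
  ∏ α ∈ posRoots n T,
    (qInf q (v α * u α * qexp q α ζ) / qInf q (v α * qexp q α ζ)) *
      (qInf q (q * v α * qexp q α ζ) / qInf q (q * v α * u α * qexp q α ζ))

/-- The points at which no denominator of the product over the positive roots vanishes. -/
def macRegular {n : ℕ} (T : RootType) (q : ℂ) (u v : E n → ℂ) : Set (E n) :=
  {ζ | ∀ α ∈ posRoots n T,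
    qInf q (v α * qexp q α ζ) ≠ 0 ∧ qInf q (q * v α * u α * qexp q α ζ) ≠ 0}

/-- `c` is the value at `ζ` of the product over the positive roots, removable singularities being
removed.  (This is how the quotients of infinite products have to be read: for instance
`(q x)_∞ / (x)_∞` is `1 / (1 - x)` also at `x = q⁻¹, q⁻², …`, where it is literally `0 / 0`.)
There is no such `c` when the product has a genuine singularity at `ζ`. -/
def MacValue {n : ℕ} (T : RootType) (q : ℂ) (u v : E n → ℂ) (ζ : E n) (c : ℂ) : Prop :=
  Tendsto (macProd T q u v) (𝓝[macRegular T q u v] ζ) (𝓝 c)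

/-- `v α` is a square root of `u (2 α)` if `2 α` is a root, and `1` otherwise. -/
def IsHalfParam {n : ℕ} (T : RootType) (u v : E n → ℂ) : Prop :=
  ∀ α ∈ posRoots n T,
    ((2 : ℝ) • α ∈ posRoots n T → v α ^ 2 = u ((2 : ℝ) • α)) ∧
    ((2 : ℝ) • α ∉ posRoots n T → v α = 1)

/-- The constant `∑_{w ∈ W} ∏_{α ∈ R(w)} u_α`. -/
noncomputable def macConst {n : ℕ} (T : RootType) (u : E n → ℂ) : ℂ :=
  ∑ w : Weyl n, ∏ α ∈ invRoots T w, u α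

end Multilateral

open Multilateral

/-!
Each quotient of infinite products telescopes, `(x)_∞ / (q x)_∞ = 1 - x`, so at a generic point the
product `Δ` is the finite product `∏ (1 - v u X) / (1 - v X)`, with `X = q ^ ⟨α, ζ⟩`.  For `BC_n`
the factors of `ε_i` and `2 ε_i` combine, because `v ε_i` is a square root of `u (2 ε_i)`, and the
pole at `v X = 1` disappears.  The resulting rational form `cFun` has poles only on the reflection
hyperplanes, and it is the value of `Δ` at every other point (`macValue_cFun`).

The symmetrization of `cFun` over the Weyl group is Macdonald's identity `sum_cFun_eq_macConst`,
with one independent parameter for each positive root.  Write `cFun` as a quotient `numer / denom`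
of Laurent polynomials, where `denom` is antisymmetric.  Antisymmetrizing a monomial gives the
determinant of `x_j ^ m_i - x_j ^ (-m_i)`.  The exponents that occur in `numer` lie in `[-n, n]`,
and for these the determinant is a multiple of the one with `m_i = i` (`exists_antisym_mono`).  So
the symmetrization is constant (`sum_numer_div_denom_const`).  The constant is read off at infinity
in the direction of `ρ`: in the term of `w`, the factor of `α` tends to `u α` if `α ∈ R(w)` and to
`1` otherwise (`tendsto_cFun`).

The weight lattice is the disjoint union of the gap, the overlap, and the sets
`w · (L⁺ \ P)` for `w ∈ W` (`weightLattice_eq`).  For `μ ∈ L⁺ \ P` the point `z + μ` lies on no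
reflection hyperplane, since the reflection would put `μ` into the overlap.  There `g` is `f` times
`cFun`, and `cFun` is bounded because the points of `z + L` off the hyperplanes keep a positive
distance from them.  The sum over the third part therefore converges absolutely, and by the
symmetry of `f` and Macdonald's identity it equals the constant times the sum of `f` over `L⁺ \ P`.
The gap contributes `0`, and the overlap contributes the constant times the sum of `f` over
`P ∩ L⁺`.
-/

namespace Macdonald

/-! ### Antisymmetrization over the hyperoctahedral group -/

/-- The action of the signed permutations on the torus `(ℂˣ)ⁿ`. -/
def torusAct {n : ℕ} (w : Weyl n) (x : Fin n → ℂˣ) : Fin n → ℂˣ :=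
  fun i => x (w.1.symm i) ^ (w.2 i : ℤ)

/-- The sign character of the group of signed permutations. -/
noncomputable def wsign {n : ℕ} (w : Weyl n) : ℂ :=
  ((Equiv.Perm.sign w.1 : ℤ) : ℂ) * ∏ i, ((w.2 i : ℤ) : ℂ)

/-- The antisymmetrization of a function on the torus `(ℂˣ)ⁿ`. -/
noncomputable def antisym {n : ℕ} (G : (Fin n → ℂˣ) → ℂ) (x : Fin n → ℂˣ) : ℂ :=
  ∑ w : Weyl n, wsign w * G (torusAct w x)

/-- The Laurent monomial `x ^ m`. -/
def mono {n : ℕ} (m : Fin n → ℤ) (x : Fin n → ℂˣ) : ℂ := ∏ i, ((x i ^ m i : ℂˣ) : ℂ)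

/-- The Laurent polynomials whose exponents in the `i`-th variable lie in `[-b i, b i]`. -/
noncomputable def monoSpan {n : ℕ} (b : Fin n → ℕ) : Submodule ℂ ((Fin n → ℂˣ) → ℂ) :=
  Submodule.span ℂ (mono '' {m | ∀ i, (m i).natAbs ≤ b i})

/-- The determinant of the matrix `x_j ^ (i + 1) - x_j ^ (-(i + 1))`, the numerator of Weyl's
denominator formula for `C_n`. -/
noncomputable def weylDet {n : ℕ} (x : Fin n → ℂˣ) : ℂ :=
  (Matrix.of fun i j : Fin n =>
    ((x j ^ ((i : ℤ) + 1) : ℂˣ) : ℂ) - ((x j ^ (-((i : ℤ) + 1)) : ℂˣ) : ℂ)).det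

lemma antisym_mono {n : ℕ} (m : Fin n → ℤ) (x : Fin n → ℂˣ) :
    antisym (mono m) x =
      (Matrix.of fun i j : Fin n =>
        ((x j ^ m i : ℂˣ) : ℂ) - ((x j ^ (-m i) : ℂˣ) : ℂ)).det := by
  rw [Matrix.det_apply', antisym, Fintype.sum_prod_type]
  refine Finset.sum_congr rfl fun σ _ => ?_
  have h : ∏ i, (Matrix.of fun i j : Fin n =>
        ((x j ^ m i : ℂˣ) : ℂ) - ((x j ^ (-m i) : ℂˣ) : ℂ)) (σ i) i =
      ∏ i, ∑ s : ℤˣ, ((s : ℤ) : ℂ) * (((x (σ.symm i) ^ (s : ℤ)) ^ m i : ℂˣ) : ℂ) := by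
    rw [← Equiv.prod_comp σ (fun i => ∑ s : ℤˣ, ((s : ℤ) : ℂ) *
      (((x (σ.symm i) ^ (s : ℤ)) ^ m i : ℂˣ) : ℂ))]
    refine Finset.prod_congr rfl fun i _ => ?_
    have hu : (Finset.univ : Finset ℤˣ) = {1, -1} := rfl
    rw [hu, Finset.sum_pair (by decide)]
    simp [sub_eq_add_neg]
  rw [h, Finset.prod_univ_sum, Finset.mul_sum, Fintype.piFinset_univ]
  refine Finset.sum_congr rfl fun s _ => ?_
  simp only [wsign, mono, torusAct, Finset.prod_mul_distrib]
  ring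

/-- The antisymmetrization of a monomial with exponents in `[-n, n]` is `0` or `±` the Weyl
determinant: after the signs are taken out, either two rows of the matrix agree, or one of them
vanishes, or the rows are a permutation of those of the Weyl determinant. -/
lemma exists_antisym_mono {n : ℕ} (m : Fin n → ℤ) (hm : ∀ i, (m i).natAbs ≤ n) :
    ∃ κ : ℂ, ∀ x, antisym (mono m) x = κ * weylDet x := by
  have key : ∀ x : Fin n → ℂˣ, antisym (mono m) x = (∏ i, (((m i).sign : ℤ) : ℂ)) *
      (Matrix.of fun i j : Fin n =>
        ((x j ^ ((m i).natAbs : ℤ) : ℂˣ) : ℂ) - ((x j ^ (-((m i).natAbs : ℤ)) : ℂˣ) : ℂ)).det := by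
    intro x
    rw [antisym_mono, ← Matrix.det_mul_column]
    congr 1
    ext i j
    simp only [Matrix.of_apply]
    rcases lt_trichotomy (m i) 0 with h | h | h
    · rw [Int.sign_eq_neg_one_of_neg h, Int.ofNat_natAbs_of_nonpos h.le]
      simp
    · simp [h]
    · rw [Int.sign_eq_one_of_pos h, Int.natAbs_of_nonneg h.le]
      simp
  by_cases h0 : ∃ i, m i = 0
  · obtain ⟨i, hi⟩ := h0
    refine ⟨0, fun x => ?_⟩
    rw [key, Finset.prod_eq_zero (Finset.mem_univ i) (by simp [hi])]
    simp
  push Not at h0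
  by_cases hinj : Function.Injective fun i => (m i).natAbs
  · let τ : Fin n → Fin n := fun i => ⟨(m i).natAbs - 1, by
      have := hm i; have := Int.natAbs_pos.2 (h0 i); omega⟩
    have hτ : ∀ i, ((τ i : ℕ) : ℤ) + 1 = ((m i).natAbs : ℤ) := fun i => by
      have := Int.natAbs_pos.2 (h0 i)
      simp only [τ]
      omega
    have hτi : Function.Injective τ := fun i j hij => hinj (by
      have h1 := hτ i
      have h2 := hτ j
      rw [hij] at h1
      simp only
      omega)
    let e : Equiv.Perm (Fin n) := Equiv.ofBijective τ (Finite.injective_iff_bijective.1 hτi)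
    refine ⟨(∏ i, (((m i).sign : ℤ) : ℂ)) * ((Equiv.Perm.sign e : ℤ) : ℂ), fun x => ?_⟩
    rw [key, mul_assoc, weylDet, ← Matrix.det_permute e]
    congr 2
    ext i j
    simp only [Matrix.of_apply, Matrix.submatrix_apply, id, ← hτ]
    rfl
  · rw [Function.Injective] at hinj
    push Not at hinj
    obtain ⟨i, j, hij, hne⟩ := hinj
    refine ⟨0, fun x => ?_⟩
    rw [key, Matrix.det_zero_of_row_eq hne]
    · simp
    · ext k
      simp only [Matrix.of_apply]
      rw [hij]

lemma exists_antisym_of_mem {n : ℕ} {G : (Fin n → ℂˣ) → ℂ} (hG : G ∈ monoSpan fun _ : Fin n => n) :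
    ∃ κ : ℂ, ∀ x, antisym G x = κ * weylDet x := by
  induction hG using Submodule.span_induction with
  | mem G hG =>
    obtain ⟨m, hm, rfl⟩ := hG
    exact exists_antisym_mono m hm
  | zero => exact ⟨0, fun x => by simp [antisym]⟩
  | add F G _ _ hF hG =>
    obtain ⟨κ, hκ⟩ := hF
    obtain ⟨κ', hκ'⟩ := hG
    refine ⟨κ + κ', fun x => ?_⟩
    rw [add_mul, ← hκ, ← hκ']
    simp [antisym, mul_add, Finset.sum_add_distrib]
  | smul c F _ hF =>
    obtain ⟨κ, hκ⟩ := hF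
    refine ⟨c * κ, fun x => ?_⟩
    rw [mul_assoc, ← hκ]
    simp only [antisym, Finset.mul_sum, Pi.smul_apply, smul_eq_mul]
    exact Finset.sum_congr rfl fun w _ => by ring

/-! ### Laurent polynomials with bounded exponents -/

lemma monoSpan_mono {n : ℕ} {b b' : Fin n → ℕ} (h : b ≤ b') : monoSpan b ≤ monoSpan b' :=
  Submodule.span_mono (Set.image_mono fun _ hm i => (hm i).trans (h i))

lemma mul_mem_monoSpan {n : ℕ} {b b' : Fin n → ℕ} {F G : (Fin n → ℂˣ) → ℂ}
    (hF : F ∈ monoSpan b) (hG : G ∈ monoSpan b') : F * G ∈ monoSpan (b + b') := by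
  have h := Submodule.mul_mem_mul hF hG
  rw [monoSpan, monoSpan, Submodule.span_mul_span] at h
  refine Submodule.span_mono ?_ h
  rintro _ ⟨_, ⟨m, hm, rfl⟩, _, ⟨m', hm', rfl⟩, rfl⟩
  refine ⟨m + m', fun i => (Int.natAbs_add_le _ _).trans (add_le_add (hm i) (hm' i)), ?_⟩
  ext x
  simp [mono, zpow_add, Finset.prod_mul_distrib]

lemma const_mem_monoSpan {n : ℕ} (b : Fin n → ℕ) (c : ℂ) :
    (fun _ => c) ∈ monoSpan b := by
  have h : (fun _ => c) = c • mono (0 : Fin n → ℤ) := by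
    ext x
    simp [mono]
  rw [h]
  exact Submodule.smul_mem _ _ (Submodule.subset_span ⟨0, by simp, rfl⟩)

lemma prod_mem_monoSpan {n : ℕ} {ι : Type*} (s : Finset ι) (b : ι → Fin n → ℕ)
    (F : ι → (Fin n → ℂˣ) → ℂ) (h : ∀ k ∈ s, F k ∈ monoSpan (b k)) :
    ∏ k ∈ s, F k ∈ monoSpan (∑ k ∈ s, b k) := by
  classical
  induction s using Finset.induction_on with
  | empty => exact const_mem_monoSpan _ 1
  | insert k s hk ih =>
    rw [Finset.prod_insert hk, Finset.sum_insert hk]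
    exact mul_mem_monoSpan (h k (by simp)) (ih fun j hj => h j (by simp [hj]))

lemma coord_mem_monoSpan {n : ℕ} {b : Fin n → ℕ} {i : Fin n} (hb : 1 ≤ b i) :
    (fun x => (x i : ℂ)) ∈ monoSpan b := by
  refine Submodule.subset_span ⟨Pi.single i 1, fun j => ?_, ?_⟩
  · by_cases h : j = i
    · subst h
      simpa using hb
    · simp [h]
  · ext x
    rw [mono, Finset.prod_eq_single i] <;> simp +contextual

lemma coord_inv_mem_monoSpan {n : ℕ} {b : Fin n → ℕ} {i : Fin n} (hb : 1 ≤ b i) :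
    (fun x => (x i : ℂ)⁻¹) ∈ monoSpan b := by
  refine Submodule.subset_span ⟨Pi.single i (-1), fun j => ?_, ?_⟩
  · by_cases h : j = i
    · subst h
      simpa using hb
    · simp [h]
  · ext x
    rw [mono, Finset.prod_eq_single i] <;> simp +contextual

/-! ### The symmetrized quotient is constant -/

/-- The numerator of the product over the positive roots, multiplied by one `x_i⁻¹` for each `i` and
one for each pair `i < j`, which makes the exponents of every variable range over `[-n, n]`.  The
roots `ε_i` and `2 ε_i` together contribute a general Laurent polynomial `x_i⁻¹ + a_i - c_i x_i`. -/
noncomputable def numer {n : ℕ} (a c : Fin n → ℂ) (p r : Fin n → Fin n → ℂ) :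
    (Fin n → ℂˣ) → ℂ :=
  (∏ i, fun x => (x i : ℂ)⁻¹ + a i - c i * x i) *
    ∏ i, ∏ j ∈ Finset.Ioi i, fun x =>
      (x i : ℂ)⁻¹ - p i j * (x j : ℂ)⁻¹ - r i j * x j + p i j * r i j * x i

/-- The denominator of the product over the positive roots: Weyl's denominator for `C_n`. -/
noncomputable def denom {n : ℕ} : (Fin n → ℂˣ) → ℂ :=
  numer (fun _ : Fin n => 0) (fun _ => 1) (fun _ _ => 1) (fun _ _ => 1)

/-- The exponent bound for `numer`: each variable occurs in one single factor and in `n - 1` pair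
factors, with exponents in `[-1, 1]`. -/
lemma sum_bound {n : ℕ} : (∑ i : Fin n, (Pi.single i 1 : Fin n → ℕ)) +
    ∑ i : Fin n, ∑ j ∈ Finset.Ioi i, (Pi.single i 1 + Pi.single j 1) ≤ fun _ : Fin n => n := by
  intro k
  simp only [Pi.add_apply, Finset.sum_apply, Finset.sum_add_distrib, Pi.single_apply,
    Finset.sum_const, Pi.smul_apply, smul_eq_mul, mul_ite, mul_one, mul_zero, Finset.sum_ite_eq,
    Finset.mem_univ, if_true, Finset.mem_Ioi]
  rw [← Finset.card_filter]
  have h : (Finset.univ.filter fun i : Fin n => i < k) = Finset.Iio k := by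
    ext
    simp
  rw [h, Fin.card_Ioi, Fin.card_Iio]
  omega

lemma numer_mem_monoSpan {n : ℕ} (a c : Fin n → ℂ) (p r : Fin n → Fin n → ℂ) :
    numer a c p r ∈ monoSpan fun _ : Fin n => n := by
  refine monoSpan_mono sum_bound (mul_mem_monoSpan (prod_mem_monoSpan _ _ _ fun i _ => ?_)
    (prod_mem_monoSpan _ _ _ fun i _ => prod_mem_monoSpan _ _ _ fun j _ => ?_))
  · have hi : 1 ≤ (Pi.single i 1 : Fin n → ℕ) i := by simp
    exact Submodule.sub_mem _ (Submodule.add_mem _ (coord_inv_mem_monoSpan hi)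
      (const_mem_monoSpan _ _)) (Submodule.smul_mem _ (c i) (coord_mem_monoSpan hi))
  · have hi : 1 ≤ (Pi.single i 1 + Pi.single j 1 : Fin n → ℕ) i := by simp
    have hj : 1 ≤ (Pi.single i 1 + Pi.single j 1 : Fin n → ℕ) j := by simp
    exact Submodule.add_mem _ (Submodule.sub_mem _ (Submodule.sub_mem _
      (coord_inv_mem_monoSpan hi) (Submodule.smul_mem _ (p i j) (coord_inv_mem_monoSpan hj)))
      (Submodule.smul_mem _ (r i j) (coord_mem_monoSpan hj)))
      (Submodule.smul_mem _ (p i j * r i j) (coord_mem_monoSpan hi))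

lemma denom_eq_vandermonde {n : ℕ} (x : Fin n → ℂˣ) :
    denom x = (∏ i, ((x i : ℂ)⁻¹ - x i)) *
      (Matrix.vandermonde fun i => -((x i : ℂ) + (x i : ℂ)⁻¹)).det := by
  rw [Matrix.det_vandermonde]
  simp only [denom, numer, Pi.mul_apply, Finset.prod_apply]
  congr 1
  · exact Finset.prod_congr rfl fun i _ => by ring
  · exact Finset.prod_congr rfl fun i _ => Finset.prod_congr rfl fun j _ => by ring

lemma denom_torusAct {n : ℕ} (w : Weyl n) (x : Fin n → ℂˣ) :
    denom (torusAct w x) = wsign w * denom x := by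
  have hinv : ∀ (y : ℂˣ) (s : ℤˣ),
      ((y ^ (s : ℤ) : ℂˣ) : ℂ)⁻¹ - ((y ^ (s : ℤ) : ℂˣ) : ℂ) = ((s : ℤ) : ℂ) * ((y : ℂ)⁻¹ - y) ∧
      -(((y ^ (s : ℤ) : ℂˣ) : ℂ) + ((y ^ (s : ℤ) : ℂˣ) : ℂ)⁻¹) = -((y : ℂ) + (y : ℂ)⁻¹) := by
    intro y s
    rcases Int.units_eq_one_or s with rfl | rfl
    · simp
    · simp
      ring
  simp only [denom_eq_vandermonde, torusAct, (hinv _ _).1, (hinv _ _).2, wsign,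
    Finset.prod_mul_distrib]
  have hdet : (Matrix.vandermonde fun i => -((x (w.1.symm i) : ℂ) + (x (w.1.symm i) : ℂ)⁻¹)).det =
      ((Equiv.Perm.sign w.1 : ℤ) : ℂ) *
        (Matrix.vandermonde fun i => -((x i : ℂ) + (x i : ℂ)⁻¹)).det := by
    rw [← Equiv.Perm.sign_symm, ← Matrix.det_permute]
    rfl
  rw [hdet, Equiv.prod_comp w.1.symm (fun i => (x i : ℂ)⁻¹ - (x i : ℂ))]
  ring

lemma wsign_mul_self {n : ℕ} (w : Weyl n) : wsign w * wsign w = 1 := by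
  have h1 : ∀ s : ℤˣ, ((s : ℤ) : ℂ) * ((s : ℤ) : ℂ) = 1 := fun s => by
    rcases Int.units_eq_one_or s with rfl | rfl <;> simp
  rw [wsign, mul_mul_mul_comm, h1, ← Finset.prod_mul_distrib]
  simp [h1]

/-- The symmetrization of `numer / denom` does not depend on the point: numerator and denominator
both antisymmetrize to multiples of the Weyl determinant. -/
theorem sum_numer_div_denom_const {n : ℕ} (a c : Fin n → ℂ) (p r : Fin n → Fin n → ℂ)
    {x y : Fin n → ℂˣ} (hx : denom x ≠ 0) (hy : denom y ≠ 0) :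
    ∑ w : Weyl n, numer a c p r (torusAct w x) / denom (torusAct w x) =
      ∑ w : Weyl n, numer a c p r (torusAct w y) / denom (torusAct w y) := by
  obtain ⟨κ, hκ⟩ := exists_antisym_of_mem (numer_mem_monoSpan a c p r)
  obtain ⟨κ', hκ'⟩ := exists_antisym_of_mem
    (numer_mem_monoSpan (fun _ : Fin n => 0) (fun _ => 1) (fun _ _ => 1) (fun _ _ => 1))
  -- As `denom` is antisymmetric, its antisymmetrization is `|W|` times itself, so it is itself a
  -- multiple of the Weyl determinant.
  have hden : ∀ x : Fin n → ℂˣ, (Fintype.card (Weyl n) : ℂ) * denom x = κ' * weylDet x := by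
    intro x
    rw [← hκ', antisym]
    change _ = ∑ w : Weyl n, wsign w * denom (torusAct w x)
    simp [denom_torusAct, ← mul_assoc, wsign_mul_self]
  have hcard : (Fintype.card (Weyl n) : ℂ) ≠ 0 := by
    exact_mod_cast Fintype.card_ne_zero
  have key : ∀ x : Fin n → ℂˣ, denom x ≠ 0 →
      ∑ w : Weyl n, numer a c p r (torusAct w x) / denom (torusAct w x) =
        κ * (Fintype.card (Weyl n) : ℂ) / κ' := by
    intro x hx
    have h0 : κ' * weylDet x ≠ 0 := by
      rw [← hden]
      exact mul_ne_zero hcard hx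
    have h1 : ∑ w : Weyl n, numer a c p r (torusAct w x) / denom (torusAct w x) =
        antisym (numer a c p r) x / denom x := by
      rw [antisym, Finset.sum_div]
      refine Finset.sum_congr rfl fun w _ => ?_
      have hw : wsign w ≠ 0 := left_ne_zero_of_mul_eq_one (wsign_mul_self w)
      rw [denom_torusAct, div_eq_div_iff (mul_ne_zero hw hx) hx]
      linear_combination (-numer a c p r (torusAct w x) * denom x) * wsign_mul_self w
    rw [h1, hκ, div_eq_div_iff hx (left_ne_zero_of_mul h0)]
    linear_combination (-κ) * hden x
  rw [key x hx, key y hy]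

/-! ### Products over the positive roots -/

lemma eps_apply {n : ℕ} (i k : Fin n) : (eps i : E n) k = if k = i then 1 else 0 := by
  simp [eps]

lemma inner_eps_left {n : ℕ} (i : Fin n) (x : E n) : inner ℝ (eps i) x = x i := by
  simp [eps, EuclideanSpace.inner_single_left]

lemma inner_eps_right {n : ℕ} (i : Fin n) (x : E n) : inner ℝ x (eps i) = x i := by
  rw [real_inner_comm, inner_eps_left]

lemma sum_eps_sub {n : ℕ} {i j : Fin n} (h : i < j) :
    ∑ k, (eps i - eps j : E n) k = 0 ∧ ∑ k, (eps i - eps j : E n) k ^ 2 = 2 := by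
  constructor
  · simp [eps_apply]
  · have : ∀ k, (eps i - eps j : E n) k ^ 2 = (if k = i then 1 else 0) + if k = j then 1 else 0 := by
      intro k
      simp only [PiLp.sub_apply, eps_apply]
      split_ifs <;> grind
    simp only [this, Finset.sum_add_distrib]
    norm_num

lemma sum_eps_add {n : ℕ} {i j : Fin n} (h : i < j) :
    ∑ k, (eps i + eps j : E n) k = 2 ∧ ∑ k, (eps i + eps j : E n) k ^ 2 = 2 := by
  constructor
  · simp [eps_apply, Finset.sum_add_distrib]
    norm_num
  · have : ∀ k, (eps i + eps j : E n) k ^ 2 = (if k = i then 1 else 0) + if k = j then 1 else 0 := by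
      intro k
      simp only [PiLp.add_apply, eps_apply]
      split_ifs <;> grind
    simp only [this, Finset.sum_add_distrib]
    norm_num

lemma sum_two_smul_eps {n : ℕ} (i : Fin n) :
    ∑ k, ((2 : ℝ) • eps i : E n) k = 2 ∧ ∑ k, ((2 : ℝ) • eps i : E n) k ^ 2 = 4 := by
  simp [eps_apply]
  norm_num

lemma sum_eps {n : ℕ} (i : Fin n) : ∑ k, (eps i : E n) k = 1 := by
  simp [eps_apply]

lemma eps_injective {n : ℕ} : Function.Injective (eps : Fin n → E n) := by
  intro i j h
  have := congrArg (fun x : E n => x i) h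
  simpa [eps_apply] using this

/-- A product over the positive roots, written in coordinates. -/
lemma prod_posRoots {n : ℕ} (T : RootType) (h : E n → ℂ) :
    ∏ α ∈ posRoots n T, h α =
      (∏ i, (h ((2 : ℝ) • eps i) * match T with
        | RootType.C => 1
        | RootType.BC => h (eps i))) *
      ∏ i, ∏ j ∈ Finset.Ioi i, h (eps i - eps j) * h (eps i + eps j) := by
  classical
  have hpair : ∀ F : Fin n → Fin n → ℂ,
      ∏ P ∈ Finset.univ.filter (fun P : Fin n × Fin n => P.1 < P.2), F P.1 P.2 =
        ∏ i, ∏ j ∈ Finset.Ioi i, F i j := fun F =>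
    Finset.prod_finset_product' _ _ _ (by simp)
  have h1 : ∏ α ∈ (Finset.univ.filter fun p : Fin n × Fin n => p.1 < p.2).image
      (fun p => (eps p.1 - eps p.2 : E n)), h α = ∏ i, ∏ j ∈ Finset.Ioi i, h (eps i - eps j) := by
    rw [Finset.prod_image, hpair fun i j => h (eps i - eps j)]
    rintro ⟨i, j⟩ hij ⟨k, l⟩ hkl heq
    have e1 := congrArg (fun x : E n => x i) heq
    have e2 := congrArg (fun x : E n => x j) heq
    simp only [Finset.coe_filter, Finset.mem_univ, true_and, Set.mem_ofPred_eq] at hij hkl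
    simp only [PiLp.sub_apply, eps_apply] at e1 e2
    clear heq
    split_ifs at e1 e2 <;>
      first
      | exact Prod.ext ‹i = k› ‹j = l›
      | (exfalso; omega)
      | linarith
  have h2 : ∏ α ∈ (Finset.univ.filter fun p : Fin n × Fin n => p.1 < p.2).image
      (fun p => (eps p.1 + eps p.2 : E n)), h α = ∏ i, ∏ j ∈ Finset.Ioi i, h (eps i + eps j) := by
    rw [Finset.prod_image, hpair fun i j => h (eps i + eps j)]
    rintro ⟨i, j⟩ hij ⟨k, l⟩ hkl heq
    have e1 := congrArg (fun x : E n => x i) heq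
    have e2 := congrArg (fun x : E n => x j) heq
    simp only [Finset.coe_filter, Finset.mem_univ, true_and, Set.mem_ofPred_eq] at hij hkl
    simp only [PiLp.add_apply, eps_apply] at e1 e2
    clear heq
    split_ifs at e1 e2 <;>
      first
      | exact Prod.ext ‹i = k› ‹j = l›
      | (exfalso; omega)
      | linarith
  have h3 : ∏ α ∈ Finset.univ.image (fun i : Fin n => ((2 : ℝ) • eps i : E n)), h α =
      ∏ i, h ((2 : ℝ) • eps i) :=
    Finset.prod_image fun i _ j _ hij =>
      eps_injective (smul_right_injective (E n) (two_ne_zero (α := ℝ)) hij)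
  have h4 : ∏ α ∈ Finset.univ.image (fun i : Fin n => (eps i : E n)), h α = ∏ i, h (eps i) :=
    Finset.prod_image fun i _ j _ hij => eps_injective hij
  -- The four families are told apart by the sum and the sum of squares of the coordinates.
  have d12 : Disjoint ((Finset.univ.filter fun p : Fin n × Fin n => p.1 < p.2).image
      (fun p => (eps p.1 - eps p.2 : E n)))
      ((Finset.univ.filter fun p : Fin n × Fin n => p.1 < p.2).image
      (fun p => (eps p.1 + eps p.2 : E n))) := by
    rw [Finset.disjoint_left]
    simp only [Finset.mem_image, Finset.mem_filter, Finset.mem_univ, true_and]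
    rintro _ ⟨P, hP, rfl⟩ ⟨P', hP', he⟩
    have := (sum_eps_sub hP).1
    rw [← he, (sum_eps_add hP').1] at this
    norm_num at this
  have d123 : Disjoint ((Finset.univ.filter fun p : Fin n × Fin n => p.1 < p.2).image
      (fun p => (eps p.1 - eps p.2 : E n)) ∪
      (Finset.univ.filter fun p : Fin n × Fin n => p.1 < p.2).image
      (fun p => (eps p.1 + eps p.2 : E n)))
      (Finset.univ.image (fun i : Fin n => ((2 : ℝ) • eps i : E n))) := by
    rw [Finset.disjoint_right]
    simp only [Finset.mem_union, Finset.mem_image, Finset.mem_filter, Finset.mem_univ, true_and]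
    rintro _ ⟨i, rfl⟩ (⟨P, hP, he⟩ | ⟨P, hP, he⟩)
    · have := (sum_two_smul_eps i).2
      rw [← he, (sum_eps_sub hP).2] at this
      norm_num at this
    · have := (sum_two_smul_eps i).2
      rw [← he, (sum_eps_add hP).2] at this
      norm_num at this
  have d1234 : Disjoint ((Finset.univ.filter fun p : Fin n × Fin n => p.1 < p.2).image
      (fun p => (eps p.1 - eps p.2 : E n)) ∪
      (Finset.univ.filter fun p : Fin n × Fin n => p.1 < p.2).image
      (fun p => (eps p.1 + eps p.2 : E n)) ∪
      Finset.univ.image (fun i : Fin n => ((2 : ℝ) • eps i : E n)))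
      (Finset.univ.image (fun i : Fin n => (eps i : E n))) := by
    rw [Finset.disjoint_right]
    simp only [Finset.mem_union, Finset.mem_image, Finset.mem_filter, Finset.mem_univ, true_and]
    rintro _ ⟨i, rfl⟩ ((⟨P, hP, he⟩ | ⟨P, hP, he⟩) | ⟨j, he⟩)
    · have := sum_eps i
      rw [← he, (sum_eps_sub hP).1] at this
      norm_num at this
    · have := sum_eps i
      rw [← he, (sum_eps_add hP).1] at this
      norm_num at this
    · have := sum_eps i
      rw [← he, (sum_two_smul_eps j).1] at this
      norm_num at this
  simp only [Finset.prod_mul_distrib]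
  cases T with
  | C =>
    rw [posRoots, Finset.union_empty]
    convert (Finset.prod_union d123).trans ?_ using 2
    rw [Finset.prod_union d12, h1, h2, h3]
    simp
    ring
  | BC =>
    rw [posRoots]
    convert (Finset.prod_union d1234).trans ?_ using 2
    rw [Finset.prod_union d123, Finset.prod_union d12, h1, h2, h3, h4]
    ring

lemma mem_posRoots {n : ℕ} {T : RootType} {α : E n} : α ∈ posRoots n T ↔
    (∃ i j, i < j ∧ (α = eps i - eps j ∨ α = eps i + eps j)) ∨
      (∃ i, α = (2 : ℝ) • eps i) ∨ (T = RootType.BC ∧ ∃ i, α = eps i) := by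
  cases T <;> simp only [posRoots, Finset.mem_union, Finset.mem_image, Finset.mem_filter,
    Finset.mem_univ, true_and, Prod.exists, Finset.notMem_empty] <;> grind

lemma sub_mem_posRoots {n : ℕ} {T : RootType} {i j : Fin n} (h : i < j) :
    (eps i - eps j : E n) ∈ posRoots n T := mem_posRoots.2 (Or.inl ⟨i, j, h, Or.inl rfl⟩)

lemma add_mem_posRoots {n : ℕ} {T : RootType} {i j : Fin n} (h : i < j) :
    (eps i + eps j : E n) ∈ posRoots n T := mem_posRoots.2 (Or.inl ⟨i, j, h, Or.inr rfl⟩)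

lemma long_mem_posRoots {n : ℕ} {T : RootType} (i : Fin n) :
    ((2 : ℝ) • eps i : E n) ∈ posRoots n T := mem_posRoots.2 (Or.inr (Or.inl ⟨i, rfl⟩))

lemma short_mem_posRoots {n : ℕ} (i : Fin n) :
    (eps i : E n) ∈ posRoots n RootType.BC := mem_posRoots.2 (Or.inr (Or.inr ⟨rfl, i, rfl⟩))

/-! ### Signed permutations -/

lemma act_apply {n : ℕ} (w : Weyl n) (x : E n) (i : Fin n) :
    act w x i = ((w.2 i : ℤ) : ℝ) * x (w.1.symm i) := rfl

lemma act_add {n : ℕ} (w : Weyl n) (x y : E n) : act w (x + y) = act w x + act w y := by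
  ext i
  simp [act_apply, mul_add]

lemma act_sub {n : ℕ} (w : Weyl n) (x y : E n) : act w (x - y) = act w x - act w y := by
  ext i
  simp [act_apply, mul_sub]

lemma act_smul {n : ℕ} (w : Weyl n) (t : ℝ) (x : E n) : act w (t • x) = t • act w x := by
  ext i
  simp [act_apply]
  ring

lemma act_neg {n : ℕ} (w : Weyl n) (x : E n) : act w (-x) = -act w x := by
  ext i
  simp [act_apply]

/-- The composition of signed permutations. -/
def wmul {n : ℕ} (w w' : Weyl n) : Weyl n := (w.1 * w'.1, fun i => w.2 i * w'.2 (w.1.symm i))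

/-- The inverse of a signed permutation. -/
def winv {n : ℕ} (w : Weyl n) : Weyl n := (w.1.symm, fun i => w.2 (w.1 i))

lemma unit_mul_self (s : ℤˣ) : ((s : ℤ) : ℝ) * ((s : ℤ) : ℝ) = 1 := by
  rcases Int.units_eq_one_or s with rfl | rfl <;> simp

lemma act_act {n : ℕ} (w w' : Weyl n) (x : E n) : act w (act w' x) = act (wmul w w') x := by
  ext i
  simp [act_apply, wmul, Equiv.Perm.mul_def, mul_assoc]

lemma act_winv {n : ℕ} (w : Weyl n) (x : E n) : act w (act (winv w) x) = x := by
  ext i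
  simp [act_apply, winv, ← mul_assoc, unit_mul_self]

lemma winv_act {n : ℕ} (w : Weyl n) (x : E n) : act (winv w) (act w x) = x := by
  ext i
  simp [act_apply, winv, ← mul_assoc, unit_mul_self]

lemma wmul_injective {n : ℕ} (w : Weyl n) : Function.Injective (wmul w) := by
  intro w₁ w₂ h
  simp only [wmul, Prod.mk.injEq] at h
  refine Prod.ext (mul_left_cancel h.1) (funext fun i => ?_)
  have := congrFun h.2 (w.1 i)
  simpa using this

lemma inner_act_act {n : ℕ} (w : Weyl n) (x y : E n) :
    inner ℝ (act w x) (act w y) = inner ℝ x y := by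
  simp only [PiLp.inner_apply, RCLike.inner_apply, conj_trivial, act_apply]
  rw [← Equiv.sum_comp w.1.symm fun i => y i * x i]
  refine Finset.sum_congr rfl fun i _ => ?_
  linear_combination (y (w.1.symm i) * x (w.1.symm i)) * unit_mul_self (w.2 i)

lemma act_eps {n : ℕ} (w : Weyl n) (i : Fin n) :
    act w (eps i) = ((w.2 (w.1 i) : ℤ) : ℝ) • eps (w.1 i) := by
  ext k
  simp only [act_apply, eps_apply, PiLp.smul_apply, smul_eq_mul, Equiv.symm_apply_eq]
  by_cases h : k = w.1 i
  · simp [h]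
  · simp [h]

lemma act_mem_roots {n : ℕ} {T : RootType} (w : Weyl n) {α : E n} (h : α ∈ posRoots n T) :
    act w α ∈ posRoots n T ∨ -act w α ∈ posRoots n T := by
  have key : ∀ i j : Fin n, i ≠ j → ∀ s t : ℤˣ,
      ((s : ℤ) : ℝ) • (eps i : E n) + ((t : ℤ) : ℝ) • eps j ∈ posRoots n T ∨
      -(((s : ℤ) : ℝ) • (eps i : E n) + ((t : ℤ) : ℝ) • eps j) ∈ posRoots n T := by
    intro i j hij s t
    rcases Int.units_eq_one_or s with rfl | rfl <;> rcases Int.units_eq_one_or t with rfl | rfl <;>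
      rcases lt_or_gt_of_ne hij with hlt | hlt <;>
      [left; left; left; right; right; left; right; right] <;>
      [convert add_mem_posRoots hlt using 1; convert add_mem_posRoots hlt using 1;
       convert sub_mem_posRoots hlt using 1; convert sub_mem_posRoots hlt using 1;
       convert sub_mem_posRoots hlt using 1; convert sub_mem_posRoots hlt using 1;
       convert add_mem_posRoots hlt using 1; convert add_mem_posRoots hlt using 1] <;>
      simp <;> abel
  rcases mem_posRoots.1 h with ⟨i, j, hij, rfl | rfl⟩ | ⟨i, rfl⟩ | ⟨rfl, i, rfl⟩
  · have := key (w.1 i) (w.1 j) (w.1.injective.ne hij.ne) (w.2 (w.1 i)) (-w.2 (w.1 j))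
    rw [act_sub, act_eps, act_eps]
    simpa [sub_eq_add_neg] using this
  · rw [act_add, act_eps, act_eps]
    exact key _ _ (w.1.injective.ne hij.ne) _ _
  · rw [act_smul, act_eps]
    rcases Int.units_eq_one_or (w.2 (w.1 i)) with hs | hs
    · left
      simpa [hs] using long_mem_posRoots (w.1 i)
    · right
      simpa [hs] using long_mem_posRoots (w.1 i)
  · rw [act_eps]
    rcases Int.units_eq_one_or (w.2 (w.1 i)) with hs | hs
    · left
      simpa [hs] using short_mem_posRoots (w.1 i)
    · right
      simpa [hs] using short_mem_posRoots (w.1 i)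

/-- Half the sum of the positive roots of `C_n`, with coordinates `n, …, 1`: a vector in the open
fundamental chamber. -/
noncomputable def rho (n : ℕ) : E n := WithLp.toLp 2 fun i => (n : ℝ) - (i : ℕ)

lemma rho_apply {n : ℕ} (i : Fin n) : rho n i = (n : ℝ) - (i : ℕ) := rfl

lemma inner_rho_pos {n : ℕ} {T : RootType} {α : E n} (h : α ∈ posRoots n T) :
    0 < inner ℝ α (rho n) := by
  have hi : ∀ i : Fin n, ((i : ℕ) : ℝ) < n := fun i => by exact_mod_cast i.2
  rcases mem_posRoots.1 h with ⟨i, j, hij, rfl | rfl⟩ | ⟨i, rfl⟩ | ⟨rfl, i, rfl⟩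
  · have : ((i : ℕ) : ℝ) < (j : ℕ) := by exact_mod_cast hij
    simp only [inner_sub_left, inner_eps_left, rho_apply]
    linarith
  · have := hi i
    have := hi j
    simp only [inner_add_left, inner_eps_left, rho_apply]
    linarith
  · have := hi i
    simp only [inner_smul_left, inner_eps_left, rho_apply, conj_trivial]
    linarith
  · have := hi i
    simp only [inner_eps_left, rho_apply]
    linarith

lemma mem_invRoots_iff {n : ℕ} {T : RootType} (w : Weyl n) {α : E n} (h : α ∈ posRoots n T) :
    α ∈ invRoots T w ↔ inner ℝ α (act w (rho n)) < 0 := by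
  classical
  have h1 : inner ℝ α (act w (rho n)) = inner ℝ (act (winv w) α) (rho n) := by
    rw [← inner_act_act (winv w), winv_act]
  rw [h1, invRoots, Finset.mem_inter, Finset.mem_image]
  constructor
  · rintro ⟨-, β, hβ, rfl⟩
    rw [act_neg, winv_act, inner_neg_left]
    linarith [inner_rho_pos hβ]
  · intro hlt
    refine ⟨h, -act (winv w) α, ?_, ?_⟩
    · rcases act_mem_roots (winv w) h with h2 | h2
      · linarith [inner_rho_pos h2]
      · exact h2
    · rw [act_neg, act_winv, neg_neg]

lemma inner_act_rho_ne_zero {n : ℕ} {T : RootType} (w : Weyl n) {α : E n}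
    (h : α ∈ posRoots n T) : inner ℝ α (act w (rho n)) ≠ 0 := by
  have h1 : inner ℝ α (act w (rho n)) = inner ℝ (act (winv w) α) (rho n) := by
    rw [← inner_act_act (winv w), winv_act]
  rw [h1]
  rcases act_mem_roots (winv w) h with h2 | h2
  · exact (inner_rho_pos h2).ne'
  · have := inner_rho_pos h2
    rw [inner_neg_left] at this
    linarith

lemma prod_invRoots {n : ℕ} (T : RootType) (u : E n → ℂ) (w : Weyl n) :
    ∏ α ∈ invRoots T w, u α =
      ∏ α ∈ posRoots n T, if inner ℝ α (act w (rho n)) < 0 then u α else 1 := by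
  classical
  rw [← Finset.prod_filter]
  refine Finset.prod_congr ?_ fun _ _ => rfl
  ext α
  rw [Finset.mem_filter]
  constructor
  · intro h
    have h' : α ∈ posRoots n T := by
      rw [invRoots] at h
      exact (Finset.mem_inter.1 h).1
    exact ⟨h', (mem_invRoots_iff w h').1 h⟩
  · rintro ⟨h, h'⟩
    exact (mem_invRoots_iff w h).2 h'

/-! ### One factor of the product -/

/-- The rational function `(1 + a x - c x²) / (1 - x²)` at `x = q ^ s`. -/
noncomputable def qfac (q a c : ℂ) (s : ℝ) : ℂ :=
  (1 + a * q ^ (s : ℂ) - c * (q ^ (s : ℂ)) ^ 2) / (1 - (q ^ (s : ℂ)) ^ 2)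

lemma cpow_ofReal_ne_zero {q : ℂ} (hq0 : q ≠ 0) (s : ℝ) : q ^ (s : ℂ) ≠ 0 := by
  simp [Complex.cpow_eq_zero_iff, hq0]

lemma cpow_half_sq {q : ℂ} (hq0 : q ≠ 0) (s : ℝ) :
    (q ^ ((s / 2 : ℝ) : ℂ)) ^ 2 = q ^ (s : ℂ) := by
  rw [sq, ← Complex.cpow_add _ _ hq0]
  congr 1
  push_cast
  ring

lemma one_sub_cpow_sq_ne_zero {q : ℂ} (hq0 : q ≠ 0) (hq1 : ‖q‖ < 1) {s : ℝ} (hs : s ≠ 0) :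
    1 - (q ^ (s : ℂ)) ^ 2 ≠ 0 := by
  intro h
  have h1 : ‖(q ^ (s : ℂ)) ^ 2‖ = 1 := by rw [← sub_eq_zero.1 h, norm_one]
  rw [norm_pow, Complex.norm_cpow_real, pow_eq_one_iff_of_nonneg (by positivity) two_ne_zero] at h1
  rcases lt_or_gt_of_ne hs with h0 | h0
  · exact (Real.one_lt_rpow_of_pos_of_lt_one_of_neg (norm_pos_iff.2 hq0) hq1 h0).ne' h1
  · exact (Real.rpow_lt_one (norm_nonneg q) hq1 h0).ne h1

/-- Rewriting of a factor in terms of `q ^ (-s)`, used for negative `s`. -/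
lemma qfac_eq_neg {q : ℂ} (hq0 : q ≠ 0) (a c : ℂ) (s : ℝ) :
    qfac q a c s = ((q ^ ((-s : ℝ) : ℂ)) ^ 2 + a * q ^ ((-s : ℝ) : ℂ) - c) /
      ((q ^ ((-s : ℝ) : ℂ)) ^ 2 - 1) := by
  have h := cpow_ofReal_ne_zero hq0 s
  rw [qfac, Complex.ofReal_neg, Complex.cpow_neg,
    ← mul_div_mul_right _ _ (pow_ne_zero 2 (inv_ne_zero h))]
  congr 1 <;> field_simp

lemma tendsto_cpow_zero {q : ℂ} (hq1 : ‖q‖ < 1) {β : ℝ} (hβ : 0 < β) :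
    Tendsto (fun t : ℝ => q ^ ((t * β : ℝ) : ℂ)) atTop (𝓝 0) := by
  rw [tendsto_zero_iff_norm_tendsto_zero]
  simp only [Complex.norm_cpow_real]
  exact (tendsto_rpow_atTop_of_base_lt_one _ (by linarith [norm_nonneg q]) hq1).comp
    (tendsto_id.atTop_mul_const hβ)

lemma tendsto_qfac {q : ℂ} (hq0 : q ≠ 0) (hq1 : ‖q‖ < 1) (a c : ℂ) {β : ℝ} (hβ : β ≠ 0) :
    Tendsto (fun t : ℝ => qfac q a c (t * β)) atTop (𝓝 (if β < 0 then c else 1)) := by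
  rcases lt_or_gt_of_ne hβ with h | h
  · have h0 := tendsto_cpow_zero hq1 (neg_pos.2 h)
    have h1 := (((h0.pow 2).add (h0.const_mul a)).sub_const c).div ((h0.pow 2).sub_const 1)
      (by norm_num)
    rw [if_pos h]
    simp only [qfac_eq_neg hq0, ← mul_neg]
    convert h1 using 2 <;> simp
  · have h0 := tendsto_cpow_zero hq1 h
    have h1 := (((h0.const_mul a).const_add 1).sub ((h0.pow 2).const_mul c)).div
      ((h0.pow 2).const_sub 1) (by norm_num)
    rw [if_neg h.le.not_gt]
    simp only [qfac]
    convert h1 using 2 <;> simp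

lemma exists_norm_qfac_le {q : ℂ} (hq0 : q ≠ 0) (hq1 : ‖q‖ < 1) (a c : ℂ) {δ : ℝ} (hδ : 0 < δ) :
    ∃ B, ∀ s : ℝ, δ ≤ |s| → ‖qfac q a c s‖ ≤ B := by
  have hq : 0 < ‖q‖ := norm_pos_iff.2 hq0
  have hr : ‖q‖ ^ δ < 1 := Real.rpow_lt_one hq.le hq1 hδ
  have hr0 : 0 < ‖q‖ ^ δ := Real.rpow_pos_of_pos hq δ
  have hsmall : ∀ s : ℝ, δ ≤ s → ‖q ^ (s : ℂ)‖ ≤ ‖q‖ ^ δ := fun s hs => by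
    rw [Complex.norm_cpow_real]
    exact Real.rpow_le_rpow_of_exponent_ge hq hq1.le hs
  have hden : ∀ x : ℂ, ‖x‖ ≤ ‖q‖ ^ δ → 1 - ‖q‖ ^ δ ≤ ‖1 - x ^ 2‖ := fun x hx => by
    have h1 : ‖(1 : ℂ)‖ - ‖x ^ 2‖ ≤ ‖1 - x ^ 2‖ := norm_sub_norm_le _ _
    rw [norm_one, norm_pow] at h1
    nlinarith [norm_nonneg x]
  refine ⟨(1 + ‖a‖ + ‖c‖) / (1 - ‖q‖ ^ δ), fun s hs => ?_⟩
  have hnum : ∀ x : ℂ, ‖x‖ ≤ ‖q‖ ^ δ → ‖1 + a * x - c * x ^ 2‖ ≤ 1 + ‖a‖ + ‖c‖ ∧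
      ‖x ^ 2 + a * x - c‖ ≤ 1 + ‖a‖ + ‖c‖ := fun x hx => by
    have hx1 : ‖x‖ ≤ 1 := hx.trans hr.le
    have hx2 : ‖x ^ 2‖ ≤ 1 := by
      rw [norm_pow]
      exact pow_le_one₀ (norm_nonneg x) hx1
    have hax : ‖a * x‖ ≤ ‖a‖ := by
      rw [norm_mul]
      exact mul_le_of_le_one_right (norm_nonneg a) hx1
    have hcx : ‖c * x ^ 2‖ ≤ ‖c‖ := by
      rw [norm_mul]
      exact mul_le_of_le_one_right (norm_nonneg c) hx2
    constructor
    · refine (norm_sub_le _ _).trans (add_le_add ((norm_add_le _ _).trans ?_) hcx)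
      rw [norm_one]
      gcongr
    · exact (norm_sub_le _ _).trans
        (add_le_add ((norm_add_le _ _).trans (add_le_add hx2 hax)) le_rfl)
  rcases le_or_gt 0 s with h0 | h0
  · rw [abs_of_nonneg h0] at hs
    rw [qfac, norm_div]
    exact div_le_div₀ (by positivity) (hnum _ (hsmall s hs)).1 (by linarith)
      (hden _ (hsmall s hs))
  · rw [abs_of_neg h0] at hs
    rw [qfac_eq_neg hq0, norm_div]
    refine div_le_div₀ (by positivity) (hnum _ (hsmall _ hs)).2 (by linarith) ?_
    rw [norm_sub_rev]
    exact hden _ (hsmall _ hs)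

lemma continuousAt_qfac {q : ℂ} (hq0 : q ≠ 0) (hq1 : ‖q‖ < 1) (a c : ℂ) {s : ℝ} (hs : s ≠ 0) :
    ContinuousAt (qfac q a c) s := by
  have h : Continuous fun s : ℝ => q ^ (s : ℂ) :=
    Complex.continuous_ofReal.const_cpow (Or.inl hq0)
  have := h.continuousAt (x := s)
  exact ContinuousAt.div (by fun_prop) (by fun_prop) (one_sub_cpow_sq_ne_zero hq0 hq1 hs)

/-- The nonzero elements of a coset of `ℤ` in `ℝ` are bounded away from zero. -/
lemma exists_le_abs_add_int (x : ℝ) : ∃ δ > 0, ∀ k : ℤ, x + k ≠ 0 → δ ≤ |x + k| := by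
  have hx := Int.fract_add_floor x
  have h0 := Int.fract_nonneg x
  have h1 := Int.fract_lt_one x
  rcases h0.eq_or_lt with hf | hf
  · refine ⟨1, one_pos, fun k hk => ?_⟩
    have he : x + k = ((⌊x⌋ + k : ℤ) : ℝ) := by
      push_cast
      linarith
    rw [he] at hk ⊢
    exact_mod_cast Int.one_le_abs (by exact_mod_cast hk)
  · refine ⟨min (Int.fract x) (1 - Int.fract x), lt_min hf (by linarith), fun k _ => ?_⟩
    have he : x + k = Int.fract x + ((⌊x⌋ + k : ℤ) : ℝ) := by
      push_cast
      linarith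
    rw [he]
    rcases le_or_gt 0 (⌊x⌋ + k) with hm | hm
    · have : (0 : ℝ) ≤ ((⌊x⌋ + k : ℤ) : ℝ) := by exact_mod_cast hm
      exact (min_le_left _ _).trans ((by linarith : _ ≤ _).trans (le_abs_self _))
    · have : ((⌊x⌋ + k : ℤ) : ℝ) ≤ -1 := by exact_mod_cast (by omega : ⌊x⌋ + k ≤ -1)
      exact (min_le_right _ _).trans ((by linarith : _ ≤ _).trans (neg_le_abs _))

lemma exists_norm_qfac_add_int_le {q : ℂ} (hq0 : q ≠ 0) (hq1 : ‖q‖ < 1) (a c : ℂ) (x : ℝ) :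
    ∃ B, ∀ k : ℤ, x + k ≠ 0 →
      ‖qfac q a c (x + k)‖ ≤ B ∧ ‖qfac q a c ((x + k) / 2)‖ ≤ B := by
  obtain ⟨δ, hδ, h⟩ := exists_le_abs_add_int x
  obtain ⟨B, hB⟩ := exists_norm_qfac_le hq0 hq1 a c (half_pos hδ)
  refine ⟨B, fun k hk => ⟨hB _ (by linarith [h k hk]), hB _ ?_⟩⟩
  rw [abs_div, abs_two]
  linarith [h k hk]

/-! ### The rational form of the product over the positive roots -/

/-- The linear coefficient of the polynomial in `q ^ ζ_i` contributed by the multiples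
of `ε_i`. -/
noncomputable def linCoef {n : ℕ} (T : RootType) (u v : E n → ℂ) (i : Fin n) : ℂ :=
  match T with
  | RootType.C => 0
  | RootType.BC => v (eps i) * (1 - u (eps i))

/-- The product of the `u_α` over the positive roots `α` that are multiples of `ε_i`: up to sign,
the quadratic coefficient of the polynomial in `q ^ ζ_i` contributed by these roots. -/
noncomputable def quadCoef {n : ℕ} (T : RootType) (u : E n → ℂ) (i : Fin n) : ℂ :=
  u ((2 : ℝ) • eps i) * match T with
    | RootType.C => 1
    | RootType.BC => u (eps i)

/-- The product over the positive roots with the infinite products cancelled, so that only the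
poles on the reflection hyperplanes are left.  For `BC_n`, the factors of `ε_i` and `2 ε_i` combine
to `(1 - s u x)(1 + s x) / (1 - x²)` with `x = q ^ ζ_i`, `s = v ε_i` and `u = u ε_i`. -/
noncomputable def cFun {n : ℕ} (T : RootType) (q : ℂ) (u v : E n → ℂ) (ζ : E n) : ℂ :=
  (∏ i, qfac q (linCoef T u v i) (quadCoef T u i) (ζ i)) *
    ∏ i, ∏ j ∈ Finset.Ioi i, qfac q 0 (u (eps i - eps j)) ((ζ i - ζ j) / 2) *
      qfac q 0 (u (eps i + eps j)) ((ζ i + ζ j) / 2)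

/-- The points that lie on no reflection hyperplane. -/
def OffWalls {n : ℕ} (ζ : E n) : Prop :=
  (∀ i, ζ i ≠ 0) ∧ ∀ i j, i ≠ j → ζ i - ζ j ≠ 0 ∧ ζ i + ζ j ≠ 0

lemma OffWalls.act {n : ℕ} {ζ : E n} (h : OffWalls ζ) (w : Weyl n) :
    OffWalls (act w ζ) := by
  refine ⟨fun i => ?_, fun i j hij => ?_⟩
  · rcases Int.units_eq_one_or (w.2 i) with hs | hs <;> simpa [act_apply, hs] using h.1 _
  · obtain ⟨h1, h2⟩ := h.2 _ _ (w.1.symm.injective.ne hij)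
    have h3 : -ζ (w.1.symm i) - ζ (w.1.symm j) ≠ 0 := fun h => h2 (by linarith)
    have h4 : -ζ (w.1.symm i) + ζ (w.1.symm j) ≠ 0 := fun h => h1 (by linarith)
    rcases Int.units_eq_one_or (w.2 i) with hs | hs <;>
      rcases Int.units_eq_one_or (w.2 j) with ht | ht <;>
      simp only [act_apply, hs, ht, Units.val_one, Units.val_neg, Int.cast_one, Int.cast_neg,
        one_mul, neg_mul, sub_neg_eq_add, ← sub_eq_add_neg] <;>
      exact ⟨by assumption, by assumption⟩

/-- The point `(q ^ ζ_i)_i` of the torus. -/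
noncomputable def torusPoint {n : ℕ} {q : ℂ} (hq0 : q ≠ 0) (ζ : E n) (i : Fin n) : ℂˣ :=
  Units.mk0 (q ^ (ζ i : ℂ)) (cpow_ofReal_ne_zero hq0 _)

lemma torusAct_torusPoint {n : ℕ} {q : ℂ} (hq0 : q ≠ 0) (w : Weyl n) (ζ : E n) :
    torusAct w (torusPoint hq0 ζ) = torusPoint hq0 (act w ζ) := by
  ext i
  rcases Int.units_eq_one_or (w.2 i) with hs | hs <;>
    simp [torusAct, torusPoint, act_apply, hs, Complex.cpow_neg]

lemma qfac_eq {q : ℂ} (hq0 : q ≠ 0) (a c : ℂ) (s : ℝ) :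
    qfac q a c s = ((q ^ (s : ℂ))⁻¹ + a - c * q ^ (s : ℂ)) / ((q ^ (s : ℂ))⁻¹ - q ^ (s : ℂ)) := by
  have h := cpow_ofReal_ne_zero hq0 s
  rw [qfac, ← mul_div_mul_right _ _ (inv_ne_zero h)]
  congr 1 <;> field_simp

lemma qfac_mul_qfac_eq {q : ℂ} (hq0 : q ≠ 0) (p r : ℂ) (s t : ℝ) :
    qfac q 0 p ((s - t) / 2) * qfac q 0 r ((s + t) / 2) =
      ((q ^ (s : ℂ))⁻¹ - p * (q ^ (t : ℂ))⁻¹ - r * q ^ (t : ℂ) + p * r * q ^ (s : ℂ)) /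
      ((q ^ (s : ℂ))⁻¹ - (q ^ (t : ℂ))⁻¹ - q ^ (t : ℂ) + q ^ (s : ℂ)) := by
  have hs := cpow_ofReal_ne_zero hq0 s
  have ht := cpow_ofReal_ne_zero hq0 t
  rw [qfac, qfac, cpow_half_sq hq0, cpow_half_sq hq0, Complex.ofReal_add, Complex.ofReal_sub,
    Complex.cpow_add _ _ hq0, Complex.cpow_sub _ _ hq0, div_mul_div_comm,
    ← mul_div_mul_right _ _ (inv_ne_zero hs)]
  congr 1 <;> field_simp <;> ring

lemma cFun_eq_numer_div_denom {n : ℕ} (T : RootType) {q : ℂ} (hq0 : q ≠ 0) (u v : E n → ℂ)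
    (ζ : E n) : cFun T q u v ζ =
      numer (linCoef T u v) (quadCoef T u) (fun i j => u (eps i - eps j))
        (fun i j => u (eps i + eps j)) (torusPoint hq0 ζ) / denom (torusPoint hq0 ζ) := by
  simp only [cFun, denom, numer, Pi.mul_apply, Finset.prod_apply, torusPoint, Units.val_mk0,
    qfac_mul_qfac_eq hq0, qfac_eq hq0 (linCoef T u v _), Finset.prod_div_distrib, div_mul_div_comm,
    one_mul, add_zero]

lemma denom_torusPoint_ne_zero {n : ℕ} {q : ℂ} (hq0 : q ≠ 0) (hq1 : ‖q‖ < 1) {ζ : E n}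
    (h : OffWalls ζ) : denom (torusPoint hq0 ζ) ≠ 0 := by
  simp only [denom, numer, Pi.mul_apply, Finset.prod_apply, torusPoint, Units.val_mk0]
  refine mul_ne_zero (Finset.prod_ne_zero_iff.2 fun i _ => ?_)
    (Finset.prod_ne_zero_iff.2 fun i _ => Finset.prod_ne_zero_iff.2 fun j hj => ?_)
  · have h1 := one_sub_cpow_sq_ne_zero hq0 hq1 (h.1 i)
    have h2 := cpow_ofReal_ne_zero hq0 (ζ i)
    intro h3
    field_simp at h3
    apply h1
    linear_combination h3
  · obtain ⟨h1, h2⟩ := h.2 i j (Finset.mem_Ioi.1 hj).ne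
    have h3 := one_sub_cpow_sq_ne_zero hq0 hq1 (div_ne_zero h1 two_ne_zero)
    have h4 := one_sub_cpow_sq_ne_zero hq0 hq1 (div_ne_zero h2 two_ne_zero)
    have hi := cpow_ofReal_ne_zero hq0 (ζ i)
    have hj := cpow_ofReal_ne_zero hq0 (ζ j)
    rw [cpow_half_sq hq0, Complex.ofReal_sub, Complex.cpow_sub _ _ hq0] at h3
    rw [cpow_half_sq hq0, Complex.ofReal_add, Complex.cpow_add _ _ hq0] at h4
    have h5 := mul_ne_zero (mul_ne_zero h3 h4) (inv_ne_zero hi)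
    convert h5 using 1
    field_simp
    ring

/-! ### Macdonald's identity -/

lemma tendsto_cFun {n : ℕ} (T : RootType) {q : ℂ} (hq0 : q ≠ 0) (hq1 : ‖q‖ < 1) (u v : E n → ℂ)
    (w : Weyl n) : Tendsto (fun t : ℝ => cFun T q u v (act w (t • rho n))) atTop
      (𝓝 (∏ α ∈ invRoots T w, u α)) := by
  have hinner : ∀ α ∈ posRoots n T, inner ℝ α (act w (rho n)) ≠ 0 :=
    fun α hα => inner_act_rho_ne_zero w hα
  have hlong : ∀ i, act w (rho n) i ≠ 0 := fun i h =>
    hinner _ (long_mem_posRoots i) (by simp [inner_smul_left, inner_eps_left, h])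
  have hsub : ∀ i j, i < j → act w (rho n) i - act w (rho n) j ≠ 0 := fun i j hij h =>
    hinner _ (sub_mem_posRoots hij) (by rw [inner_sub_left, inner_eps_left, inner_eps_left, h])
  have hadd : ∀ i j, i < j → act w (rho n) i + act w (rho n) j ≠ 0 := fun i j hij h =>
    hinner _ (add_mem_posRoots hij) (by rw [inner_add_left, inner_eps_left, inner_eps_left, h])
  have hlim : ∏ α ∈ invRoots T w, u α =
      (∏ i, if act w (rho n) i < 0 then quadCoef T u i else 1) *
      ∏ i, ∏ j ∈ Finset.Ioi i,
        (if (act w (rho n) i - act w (rho n) j) / 2 < 0 then u (eps i - eps j) else 1) *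
        (if (act w (rho n) i + act w (rho n) j) / 2 < 0 then u (eps i + eps j) else 1) := by
    rw [prod_invRoots, prod_posRoots]
    have h2 : ∀ x : ℝ, x / 2 < 0 ↔ x < 0 := fun x => by
      constructor <;> intro h <;> linarith
    have h2' : ∀ x : ℝ, 2 * x < 0 ↔ x < 0 := fun x => by
      constructor <;> intro h <;> linarith
    congr 1
    · refine Finset.prod_congr rfl fun i _ => ?_
      cases T <;> simp only [quadCoef, inner_smul_left, inner_eps_left, conj_trivial, h2'] <;>
        split_ifs <;> simp
    · simp only [inner_sub_left, inner_add_left, inner_eps_left, h2]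
  rw [hlim]
  simp only [cFun, act_smul, PiLp.smul_apply, smul_eq_mul, ← mul_sub, ← mul_add, mul_div_assoc]
  refine Tendsto.mul (tendsto_finsetProd _ fun i _ => tendsto_qfac hq0 hq1 _ _ (hlong i))
    (tendsto_finsetProd _ fun i _ => tendsto_finsetProd _ fun j hj => Tendsto.mul ?_ ?_)
  · exact tendsto_qfac hq0 hq1 _ _ (div_ne_zero (hsub i j (Finset.mem_Ioi.1 hj)) two_ne_zero)
  · exact tendsto_qfac hq0 hq1 _ _ (div_ne_zero (hadd i j (Finset.mem_Ioi.1 hj)) two_ne_zero)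

lemma offWalls_smul_rho {n : ℕ} {t : ℝ} (ht : 0 < t) : OffWalls (t • rho n) := by
  have hi : ∀ i : Fin n, ((i : ℕ) : ℝ) < n := fun i => by exact_mod_cast i.2
  simp only [OffWalls, PiLp.smul_apply, smul_eq_mul, rho_apply, ← mul_sub, ← mul_add]
  refine ⟨fun i => mul_ne_zero ht.ne' (by linarith [hi i]), fun i j hij =>
    ⟨mul_ne_zero ht.ne' fun h => hij ?_, mul_ne_zero ht.ne' (by linarith [hi i, hi j])⟩⟩
  have : ((i : ℕ) : ℝ) = (j : ℕ) := by linarith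
  exact Fin.ext (by exact_mod_cast this)

/-- **Macdonald's identity**, with independent parameters: the symmetrization of the product over
the positive roots is constant, and its value is found by moving to infinity inside a chamber, where
the factor of `α` in the term of `w` tends to `u α` or `1` according as `α ∈ R(w)` or not. -/
theorem sum_cFun_eq_macConst {n : ℕ} (T : RootType) {q : ℂ} (hq0 : q ≠ 0) (hq1 : ‖q‖ < 1)
    (u v : E n → ℂ) {ζ : E n} (hζ : OffWalls ζ) :
    ∑ w : Weyl n, cFun T q u v (act w ζ) = macConst T u := by
  have hlim : Tendsto (fun t : ℝ => ∑ w : Weyl n, cFun T q u v (act w (t • rho n))) atTop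
      (𝓝 (macConst T u)) := tendsto_finsetSum _ fun w _ => tendsto_cFun T hq0 hq1 u v w
  refine tendsto_nhds_unique (tendsto_const_nhds.congr' ?_) hlim
  filter_upwards [eventually_gt_atTop 0] with t ht
  simp only [cFun_eq_numer_div_denom T hq0, ← torusAct_torusPoint]
  exact sum_numer_div_denom_const _ _ _ _ (denom_torusPoint_ne_zero hq0 hq1 hζ)
    (denom_torusPoint_ne_zero hq0 hq1 (offWalls_smul_rho ht))

/-! ### The limits of the product at points off the walls -/

lemma qInf_eq_mul {q : ℂ} (hq1 : ‖q‖ < 1) (x : ℂ) : qInf q x = (1 - x) * qInf q (q * x) := by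
  have hsum : Summable fun k : ℕ => ‖-(q * x * q ^ k)‖ := by
    simp only [norm_neg, norm_mul, norm_pow]
    exact (summable_geometric_of_lt_one (norm_nonneg q) hq1).mul_left _
  have hm : Multipliable fun k : ℕ => 1 - q * x * q ^ k := by
    simpa [sub_eq_add_neg] using multipliable_one_add_of_summable hsum
  have hshift : (fun k : ℕ => 1 - x * q ^ (k + 1)) = fun k : ℕ => 1 - q * x * q ^ k := by
    ext k
    ring
  rw [qInf, qInf, tprod_eq_zero_mul' (by rw [hshift]; exact hm), hshift]
  simp

lemma qInf_quotient {q : ℂ} (hq1 : ‖q‖ < 1) {y x : ℂ} (hx : qInf q x ≠ 0)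
    (hy : qInf q (q * y) ≠ 0) :
    (qInf q y / qInf q x) * (qInf q (q * x) / qInf q (q * y)) = (1 - y) / (1 - x) := by
  rw [qInf_eq_mul hq1 x] at hx ⊢
  rw [qInf_eq_mul hq1 y]
  have h1 := left_ne_zero_of_mul hx
  have h2 := right_ne_zero_of_mul hx
  rw [div_mul_div_comm, div_eq_div_iff (mul_ne_zero hx hy) h1]
  ring

lemma one_sub_ne_zero_of_qInf {q : ℂ} (hq1 : ‖q‖ < 1) {x : ℂ} (hx : qInf q x ≠ 0) :
    1 - x ≠ 0 := by
  rw [qInf_eq_mul hq1 x] at hx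
  exact left_ne_zero_of_mul hx

lemma sum_sq_le {n : ℕ} {T : RootType} {α : E n} (h : α ∈ posRoots n T) : ∑ k, α k ^ 2 ≤ 4 := by
  rcases mem_posRoots.1 h with ⟨i, j, hij, rfl | rfl⟩ | ⟨i, rfl⟩ | ⟨rfl, i, rfl⟩
  · rw [(sum_eps_sub hij).2]
    norm_num
  · rw [(sum_eps_add hij).2]
    norm_num
  · rw [(sum_two_smul_eps i).2]
  · simp [eps_apply]

lemma two_smul_notMem_posRoots {n : ℕ} {T : RootType} {α : E n} (h : 1 < ∑ k, α k ^ 2) :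
    (2 : ℝ) • α ∉ posRoots n T := fun hα => by
  have h1 := sum_sq_le hα
  simp only [PiLp.smul_apply, smul_eq_mul, mul_pow, ← Finset.mul_sum] at h1
  linarith

lemma qfac_zero_half {q : ℂ} (hq0 : q ≠ 0) (c : ℂ) (s : ℝ) :
    qfac q 0 c (s / 2) = (1 - c * q ^ (s : ℂ)) / (1 - q ^ (s : ℂ)) := by
  rw [qfac, cpow_half_sq hq0]
  simp

lemma macProd_eq_cFun {n : ℕ} (T : RootType) {q : ℂ} (hq0 : q ≠ 0) (hq1 : ‖q‖ < 1)
    {u v : E n → ℂ} (huv : IsHalfParam T u v) {ζ : E n} (hζ : ζ ∈ macRegular T q u v) :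
    macProd T q u v ζ = cFun T q u v ζ := by
  have hfac : ∀ α ∈ posRoots n T,
      (qInf q (v α * u α * qexp q α ζ) / qInf q (v α * qexp q α ζ)) *
        (qInf q (q * v α * qexp q α ζ) / qInf q (q * v α * u α * qexp q α ζ)) =
      (1 - v α * u α * qexp q α ζ) / (1 - v α * qexp q α ζ) := by
    intro α hα
    obtain ⟨h1, h2⟩ := hζ α hα
    simp only [mul_assoc] at h1 h2 ⊢
    exact qInf_quotient hq1 h1 h2
  have hlong : ∀ i, v ((2 : ℝ) • eps i) = 1 := fun i =>
    (huv _ (long_mem_posRoots i)).2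
      (two_smul_notMem_posRoots (by rw [(sum_two_smul_eps i).2]; norm_num))
  have hexp : ∀ i, qexp q ((2 : ℝ) • eps i) ζ = (q ^ (ζ i : ℂ)) ^ 2 := fun i => by
    rw [qexp, inner_smul_left, inner_eps_left, conj_trivial, ← cpow_half_sq hq0]
    congr 4
    ring
  rw [macProd, Finset.prod_congr rfl hfac, prod_posRoots, cFun]
  congr 1
  · refine Finset.prod_congr rfl fun i _ => ?_
    rw [hlong, hexp]
    cases T with
    | C => simp [qfac, linCoef, quadCoef]
    | BC =>
      have hsq : v (eps i) ^ 2 = u ((2 : ℝ) • eps i) :=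
        (huv _ (short_mem_posRoots i)).1 (long_mem_posRoots i)
      have h1 := one_sub_ne_zero_of_qInf hq1 (hζ _ (short_mem_posRoots i)).1
      have h2 := one_sub_ne_zero_of_qInf hq1 (hζ _ (long_mem_posRoots i)).1
      rw [hlong, hexp, one_mul] at h2
      have he : qexp q (eps i) ζ = q ^ (ζ i : ℂ) := by rw [qexp, inner_eps_left]
      rw [he] at h1 ⊢
      -- Since `u (2 ε_i) = s²`, the factor `1 - s x` divides `1 - s² x²` and cancels the pole.
      simp only [qfac, linCoef, quadCoef, ← hsq, one_mul]
      rw [div_mul_div_comm, div_eq_div_iff (mul_ne_zero h2 h1) h2]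
      ring
  · refine Finset.prod_congr rfl fun i _ => Finset.prod_congr rfl fun j hj => ?_
    have hij := Finset.mem_Ioi.1 hj
    have h1 : v (eps i - eps j) = 1 := (huv _ (sub_mem_posRoots hij)).2
      (two_smul_notMem_posRoots (by rw [(sum_eps_sub hij).2]; norm_num))
    have h2 : v (eps i + eps j) = 1 := (huv _ (add_mem_posRoots hij)).2
      (two_smul_notMem_posRoots (by rw [(sum_eps_add hij).2]; norm_num))
    rw [h1, h2, qfac_zero_half hq0, qfac_zero_half hq0, qexp, qexp, inner_sub_left, inner_add_left,
      inner_eps_left, inner_eps_left]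
    simp only [one_mul]

lemma continuousAt_cFun {n : ℕ} (T : RootType) {q : ℂ} (hq0 : q ≠ 0) (hq1 : ‖q‖ < 1)
    (u v : E n → ℂ) {ζ : E n} (hζ : OffWalls ζ) : ContinuousAt (cFun T q u v) ζ := by
  have hc : ∀ i, ContinuousAt (fun ξ : E n => ξ i) ζ := fun i => by fun_prop
  refine Tendsto.mul (tendsto_finsetProd _ fun i _ => ?_)
    (tendsto_finsetProd _ fun i _ => tendsto_finsetProd _ fun j hj => Tendsto.mul ?_ ?_)
  · exact (continuousAt_qfac hq0 hq1 _ _ (hζ.1 i)).tendsto.comp (hc i)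
  · have h := (hζ.2 i j (Finset.mem_Ioi.1 hj).ne).1
    exact (continuousAt_qfac hq0 hq1 0 _ (div_ne_zero h two_ne_zero)).tendsto.comp
      (((hc i).sub (hc j)).div_const 2)
  · have h := (hζ.2 i j (Finset.mem_Ioi.1 hj).ne).2
    exact (continuousAt_qfac hq0 hq1 0 _ (div_ne_zero h two_ne_zero)).tendsto.comp
      (((hc i).add (hc j)).div_const 2)

lemma macValue_cFun {n : ℕ} (T : RootType) {q : ℂ} (hq0 : q ≠ 0) (hq1 : ‖q‖ < 1)
    {u v : E n → ℂ} (huv : IsHalfParam T u v) {ζ : E n} (hζ : OffWalls ζ) :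
    MacValue T q u v ζ (cFun T q u v ζ) := by
  refine ((continuousAt_cFun T hq0 hq1 u v hζ).tendsto.mono_left nhdsWithin_le_nhds).congr' ?_
  filter_upwards [self_mem_nhdsWithin] with ξ hξ
  exact (macProd_eq_cFun T hq0 hq1 huv hξ).symm

/-! ### The weight lattice -/

lemma inner_coroot {n : ℕ} (μ α : E n) :
    inner ℝ μ (coroot α) = 2 / inner ℝ α α * inner ℝ μ α := by
  rw [coroot, inner_smul_right]

lemma exists_int_of_mem_weightLattice {n : ℕ} {T : RootType} {μ : E n}
    (h : μ ∈ weightLattice n T) (i : Fin n) : ∃ k : ℤ, μ i = k := by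
  obtain ⟨k, hk⟩ := h _ (Or.inl (long_mem_posRoots i))
  refine ⟨k, ?_⟩
  rw [← hk, inner_coroot]
  simp only [inner_smul_left, inner_smul_right, conj_trivial, inner_eps_right,
    eps_apply, if_true]
  ring

lemma dominantWeights_subset {n : ℕ} {T : RootType} :
    dominantWeights n T ⊆ weightLattice n T := by
  rintro μ h α (hα | hα)
  · obtain ⟨k, hk⟩ := h α hα
    exact ⟨k, by exact_mod_cast hk⟩
  · obtain ⟨k, hk⟩ := h _ hα
    refine ⟨-k, ?_⟩
    rw [inner_coroot] at hk ⊢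
    rw [inner_neg_neg, inner_neg_right] at hk
    push_cast
    linarith

/-- The rational form of the product is bounded on the points of a translate of the weight lattice
that lie off the walls: these points keep a positive distance from the walls. -/
lemma exists_norm_cFun_le {n : ℕ} (T : RootType) {q : ℂ} (hq0 : q ≠ 0) (hq1 : ‖q‖ < 1)
    (u v : E n → ℂ) (z : E n) :
    ∃ B, ∀ μ ∈ weightLattice n T, OffWalls (z + μ) → ‖cFun T q u v (z + μ)‖ ≤ B := by
  choose B₁ h₁ using fun i => exists_norm_qfac_add_int_le hq0 hq1 (linCoef T u v i)
    (quadCoef T u i) (z i)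
  choose B₂ h₂ using fun i j => exists_norm_qfac_add_int_le hq0 hq1 0
    (u (eps i - eps j)) (z i - z j)
  choose B₃ h₃ using fun i j => exists_norm_qfac_add_int_le hq0 hq1 0
    (u (eps i + eps j)) (z i + z j)
  refine ⟨(∏ i, B₁ i) * ∏ i, ∏ j ∈ Finset.Ioi i, B₂ i j * B₃ i j, fun μ hμ hw => ?_⟩
  choose k hk using exists_int_of_mem_weightLattice hμ
  have e₁ : ∀ i, (z + μ) i = z i + k i := fun i => by simp [hk]
  have e₂ : ∀ i j, (z + μ) i - (z + μ) j = z i - z j + ((k i - k j : ℤ) : ℝ) := fun i j => by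
    rw [e₁, e₁]
    push_cast
    ring
  have e₃ : ∀ i j, (z + μ) i + (z + μ) j = z i + z j + ((k i + k j : ℤ) : ℝ) := fun i j => by
    rw [e₁, e₁]
    push_cast
    ring
  have b₁ : ∀ i, ‖qfac q (linCoef T u v i) (quadCoef T u i) ((z + μ) i)‖ ≤ B₁ i := fun i => by
    have := hw.1 i
    rw [e₁] at this ⊢
    exact (h₁ i _ this).1
  have b₂ : ∀ i, ∀ j ∈ Finset.Ioi i,
      ‖qfac q 0 (u (eps i - eps j)) (((z + μ) i - (z + μ) j) / 2)‖ ≤ B₂ i j := fun i j hj => by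
    have := (hw.2 i j (Finset.mem_Ioi.1 hj).ne).1
    rw [e₂] at this ⊢
    exact (h₂ i j _ this).2
  have b₃ : ∀ i, ∀ j ∈ Finset.Ioi i,
      ‖qfac q 0 (u (eps i + eps j)) (((z + μ) i + (z + μ) j) / 2)‖ ≤ B₃ i j := fun i j hj => by
    have := (hw.2 i j (Finset.mem_Ioi.1 hj).ne).2
    rw [e₃] at this ⊢
    exact (h₃ i j _ this).2
  rw [cFun, norm_mul]
  simp only [norm_prod, norm_mul]
  refine mul_le_mul (Finset.prod_le_prod (fun i _ => norm_nonneg _) fun i _ => b₁ i)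
    (Finset.prod_le_prod (fun i _ => by positivity) fun i _ =>
      Finset.prod_le_prod (fun j _ => by positivity) fun j hj =>
        mul_le_mul (b₂ i j hj) (b₃ i j hj) (norm_nonneg _) ((norm_nonneg _).trans (b₂ i j hj)))
    (by positivity) (Finset.prod_nonneg fun i _ => (norm_nonneg _).trans (b₁ i))

/-! ### The Weyl group with a translated center -/

lemma act_one {n : ℕ} (x : E n) : act (1 : Weyl n) x = x := by
  have h1 : (1 : Equiv.Perm (Fin n)).symm = 1 := rfl
  ext i
  simp [act_apply, h1]

/-- A point with trivial stabilizer is off the walls, as a point on a wall is fixed by the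
reflection in that wall. -/
lemma offWalls_of_act_ne {n : ℕ} {ζ : E n} (h : ∀ w : Weyl n, act w ζ = ζ → w = 1) :
    OffWalls ζ := by
  have hne : (-1 : ℤˣ) ≠ 1 := by decide
  have hone : (1 : Equiv.Perm (Fin n)).symm = 1 := rfl
  refine ⟨fun i hi => ?_, fun i j hij => ⟨fun hs => ?_, fun hs => ?_⟩⟩
  · have h1 := h (1, Function.update 1 i (-1)) (by
      ext k
      by_cases hk : k = i
      · subst hk
        simp [act_apply, hone, hi]
      · simp [act_apply, hone, hk])
    have h2 := congrFun (congrArg Prod.snd h1) i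
    simp only [Function.update_self] at h2
    exact hne h2
  · have h1 := h (Equiv.swap i j, 1) (by
      ext k
      simp only [act_apply, Equiv.symm_swap, Equiv.swap_apply_def, Pi.one_apply, Units.val_one,
        Int.cast_one, one_mul]
      split_ifs with h1 h2
      · subst h1
        linarith
      · subst h2
        linarith
      · rfl)
    exact hij (Equiv.swap_eq_one_iff.1 (congrArg Prod.fst h1))
  · have h1 := h (Equiv.swap i j, Function.update (Function.update 1 i (-1)) j (-1)) (by
      ext k
      simp only [act_apply, Equiv.symm_swap, Equiv.swap_apply_def, Function.update_apply,
        Pi.one_apply]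
      by_cases hki : k = i
      · subst hki
        simp [hij]
        linarith
      · by_cases hkj : k = j
        · subst hkj
          simp [hki]
          linarith
        · simp [hki, hkj])
    exact hij (Equiv.swap_eq_one_iff.1 (congrArg Prod.fst h1))

lemma add_actAt {n : ℕ} (z : E n) (w : Weyl n) (μ : E n) : z + actAt z w μ = act w (z + μ) := by
  simp [actAt]

lemma actAt_actAt {n : ℕ} (z : E n) (w w' : Weyl n) (μ : E n) :
    actAt z w (actAt z w' μ) = actAt z (wmul w w') μ := by
  rw [actAt, add_actAt, act_act, actAt]

lemma actAt_winv {n : ℕ} (z : E n) (w : Weyl n) (μ : E n) : actAt z w (actAt z (winv w) μ) = μ := by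
  rw [actAt, add_actAt, act_winv]
  simp

lemma winv_actAt {n : ℕ} (z : E n) (w : Weyl n) (μ : E n) : actAt z (winv w) (actAt z w μ) = μ := by
  rw [actAt, add_actAt, winv_act]
  simp

lemma actAt_injective {n : ℕ} (z : E n) (w : Weyl n) : Function.Injective (actAt z w) :=
  Function.LeftInverse.injective (winv_actAt z w)

lemma actAt_mem_weightLattice {n : ℕ} {T : RootType} {z : E n} (hz : LatticeInvariant T z)
    (w : Weyl n) {μ : E n} (hμ : μ ∈ weightLattice n T) : actAt z w μ ∈ weightLattice n T := by
  obtain ⟨l, ⟨hl, rfl⟩, -⟩ := hz (winv w) μ hμ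
  rwa [actAt_winv]

lemma actAt_mem_overlap {n : ℕ} {T : RootType} {z : E n} (hz : LatticeInvariant T z)
    (w : Weyl n) {μ : E n} (hμ : μ ∈ overlap T z) : actAt z w μ ∈ overlap T z := by
  obtain ⟨hL, w₁, w₂, hne, ⟨l₁, hl₁, rfl⟩, ⟨l₂, hl₂, h⟩⟩ := hμ
  refine ⟨actAt_mem_weightLattice hz w hL, wmul w w₁, wmul w w₂,
    fun he => hne (wmul_injective w he), ⟨l₁, hl₁, (actAt_actAt ..).symm⟩, ⟨l₂, hl₂, ?_⟩⟩
  rw [← actAt_actAt, h]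

/-- For a dominant weight `μ` outside the overlap, `z + μ` lies off the walls: a reflection fixing
`z + μ` would put `μ` into the overlap. -/
lemma offWalls_of_notMem_overlap {n : ℕ} {T : RootType} {z μ : E n}
    (hμ : μ ∈ dominantWeights n T) (hP : μ ∉ overlap T z) : OffWalls (z + μ) := by
  refine offWalls_of_act_ne fun w hw => ?_
  by_contra hne
  refine hP ⟨dominantWeights_subset hμ, w, 1, hne, ⟨μ, hμ, ?_⟩, ⟨μ, hμ, ?_⟩⟩
  · rw [actAt, hw]
    simp
  · rw [actAt, act_one]
    simp

lemma actAt_notMem_overlap {n : ℕ} {T : RootType} {z μ : E n} (hz : LatticeInvariant T z)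
    (w : Weyl n) (hP : μ ∉ overlap T z) : actAt z w μ ∉ overlap T z := fun h => hP (by
  have := actAt_mem_overlap hz (winv w) h
  rwa [winv_actAt] at this)

/-- The weight lattice is made up of the gap, the overlap, and the images of the dominant weights
outside the overlap. -/
lemma weightLattice_eq {n : ℕ} {T : RootType} {z : E n} (hz : LatticeInvariant T z) :
    weightLattice n T = (gap T z ∪ overlap T z) ∪
      ⋃ w ∈ (Finset.univ : Finset (Weyl n)), actAt z w '' (dominantWeights n T \ overlap T z) := by
  ext μ
  simp only [Finset.mem_univ, Set.iUnion_true, Set.mem_union, Set.mem_iUnion]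
  constructor
  · intro hμ
    by_cases hg : μ ∈ gap T z
    · exact Or.inl (Or.inl hg)
    · have h1 : μ ∈ ⋃ w : Weyl n, actAt z w '' dominantWeights n T := by
        by_contra h
        exact hg ⟨hμ, h⟩
      obtain ⟨w, l, hl, rfl⟩ := Set.mem_iUnion.1 h1
      by_cases hP : l ∈ overlap T z
      · exact Or.inl (Or.inr (actAt_mem_overlap hz w hP))
      · exact Or.inr ⟨w, l, ⟨hl, hP⟩, rfl⟩
  · rintro ((h | h) | ⟨w, l, hl, rfl⟩)
    · exact h.1
    · exact h.1
    · exact actAt_mem_weightLattice hz w (dominantWeights_subset hl.1)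

lemma summable_subtype_mono {β : Type*} {s t : Set β} (h : s ⊆ t) (G : β → ℂ)
    (ht : Summable fun x : t => G x) : Summable fun x : s => G x :=
  ht.comp_injective (Set.inclusion_injective h)

lemma hasSum_image_of_injective {α β : Type*} {φ : α → β} (hφ : Function.Injective φ) (s : Set α)
    (G : β → ℂ) {a : ℂ} (h : HasSum (fun x : s => G (φ x)) a) :
    HasSum (G ∘ ((↑) : ↥(φ '' s) → β)) a :=
  (Equiv.Set.image φ s hφ).hasSum_iff.1 h

end Macdonald

open Macdonald

theorem mainTheorem10 (n : ℕ) (T : RootType)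
    (q : ℂ) (hq0 : q ≠ 0) (hq1 : ‖q‖ < 1)
    (u v : E n → ℂ) (huv : IsHalfParam T u v)
    -- the summand, its Weyl group invariant domain of definition, and its symmetry
    (dom : Set (E n)) (hdom : ∀ w : Weyl n, ∀ ζ ∈ dom, act w ζ ∈ dom)
    (f : E n → ℂ) (hf : ∀ w : Weyl n, ∀ ζ ∈ dom, f (act w ζ) = f ζ)
    -- the center
    (z : E n) (hz : LatticeInvariant T z) (hC : chamber n T ⊆ chamberAt T z)
    -- the sum over the dominant weights is well defined and convergent
    (hfdom : ∀ μ ∈ dominantWeights n T, z + μ ∈ dom)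
    (hfsum : Summable fun μ : dominantWeights n T => f (z + μ))
    -- `g` is `f` times the product of the Macdonald factors, wherever both are defined
    (g : E n → ℂ)
    (hg : ∀ μ ∈ weightLattice n T, z + μ ∈ dom →
      ∀ c : ℂ, MacValue T q u v (z + μ) c → g (z + μ) = f (z + μ) * c)
    -- the gap condition
    (hgap : HasSum (fun μ : gap T z => g (z + μ)) 0)
    -- the overlap condition
    (hoverlap : HasSum (fun μ : overlap T z => g (z + μ))
      (macConst T u * ∑' μ : ↥(overlap T z ∩ dominantWeights n T), f (z + μ))) :
    HasSum (fun μ : weightLattice n T => g (z + μ))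
      (macConst T u * ∑' μ : dominantWeights n T, f (z + μ)) := by
  set S : Set (E n) := dominantWeights n T \ overlap T z with hS
  have hoff : ∀ μ ∈ S, OffWalls (z + μ) := fun μ hμ => offWalls_of_notMem_overlap hμ.1 hμ.2
  have hfS : Summable fun μ : S => f (z + μ) :=
    summable_subtype_mono Set.sdiff_subset (fun μ => f (z + μ)) hfsum
  have hfPD : Summable fun μ : ↥(overlap T z ∩ dominantWeights n T) => f (z + μ) :=
    summable_subtype_mono Set.inter_subset_right (fun μ => f (z + μ)) hfsum
  -- Off the walls, `g` is `f` times the bounded rational form of the product.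
  have hgS : ∀ w : Weyl n, ∀ μ ∈ S,
      g (z + actAt z w μ) = f (z + μ) * cFun T q u v (act w (z + μ)) := by
    intro w μ hμ
    have hd := hfdom μ hμ.1
    have h1 := hg (actAt z w μ) (actAt_mem_weightLattice hz w (dominantWeights_subset hμ.1))
      (by rw [add_actAt]; exact hdom w _ hd) _
      (macValue_cFun T hq0 hq1 huv (by rw [add_actAt]; exact (hoff μ hμ).act w))
    rw [h1, add_actAt, hf w _ hd]
  obtain ⟨B, hB⟩ := exists_norm_cFun_le T hq0 hq1 u v z
  have hsum : ∀ w : Weyl n, Summable fun μ : S => f (z + μ) * cFun T q u v (act w (z + μ)) := by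
    intro w
    refine Summable.of_norm_bounded (hfS.norm.mul_right B) fun μ => ?_
    rw [norm_mul]
    refine mul_le_mul_of_nonneg_left ?_ (norm_nonneg _)
    rw [← add_actAt]
    exact hB _ (actAt_mem_weightLattice hz w (dominantWeights_subset μ.2.1))
      (by rw [add_actAt]; exact (hoff μ μ.2).act w)
  have himage : ∀ w ∈ (Finset.univ : Finset (Weyl n)),
      HasSum ((fun μ => g (z + μ)) ∘ ((↑) : ↥(actAt z w '' S) → E n))
        (∑' μ : S, f (z + μ) * cFun T q u v (act w (z + μ))) := by
    intro w _
    refine hasSum_image_of_injective (actAt_injective z w) S (fun μ => g (z + μ)) ?_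
    have h : (fun μ : S => g (z + actAt z w μ)) =
        fun μ : S => f (z + μ) * cFun T q u v (act w (z + μ)) := funext fun μ => hgS w μ μ.2
    rw [h]
    exact (hsum w).hasSum
  have hdisj : ((Finset.univ : Finset (Weyl n)) : Set (Weyl n)).Pairwise
      (Function.onFun Disjoint fun w => actAt z w '' S) := by
    intro w _ w' _ hne
    rw [Function.onFun, Set.disjoint_left]
    rintro _ ⟨μ, hμ, rfl⟩ ⟨μ', hμ', he⟩
    exact actAt_notMem_overlap hz w hμ.2
      ⟨actAt_mem_weightLattice hz w (dominantWeights_subset hμ.1), w, w', hne,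
        ⟨μ, hμ.1, rfl⟩, ⟨μ', hμ'.1, he⟩⟩
  -- Summing over the Weyl group first turns Macdonald's identity into the constant factor.
  have hval : ∑ w : Weyl n, ∑' μ : S, f (z + μ) * cFun T q u v (act w (z + μ)) =
      macConst T u * ∑' μ : S, f (z + μ) := by
    rw [← Summable.tsum_finsetSum fun w _ => hsum w, ← tsum_mul_left]
    refine tsum_congr fun μ => ?_
    rw [← Finset.mul_sum, sum_cFun_eq_macConst T hq0 hq1 u v (hoff μ μ.2), mul_comm]
  have hrest := hasSum_sum_disjoint Finset.univ hdisj himage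
  rw [hval] at hrest
  have hsplit : ∑' μ : dominantWeights n T, f (z + μ) =
      ∑' μ : ↥(overlap T z ∩ dominantWeights n T), f (z + μ) + ∑' μ : S, f (z + μ) := by
    have hd : Disjoint (overlap T z ∩ dominantWeights n T) S := by
      rw [Set.disjoint_left]
      exact fun μ h h' => h'.2 h.1
    have h := (HasSum.add_disjoint (f := fun μ : E n => f (z + μ)) hd hfPD.hasSum hfS.hasSum).tsum_eq
    rw [← h, hS, Set.inter_comm, Set.inter_union_sdiff]
    rfl
  have hd1 : Disjoint (gap T z) (overlap T z) := by
    rw [Set.disjoint_left]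
    rintro μ h ⟨-, w, -, -, hw, -⟩
    exact h.2 (Set.mem_iUnion.2 ⟨w, hw⟩)
  have hd2 : Disjoint (gap T z ∪ overlap T z)
      (⋃ w ∈ (Finset.univ : Finset (Weyl n)), actAt z w '' S) := by
    rw [Set.disjoint_left]
    intro μ h h'
    simp only [Finset.mem_univ, Set.iUnion_true, Set.mem_iUnion] at h'
    obtain ⟨w, l, hl, rfl⟩ := h'
    rcases h with h | h
    · exact h.2 (Set.mem_iUnion.2 ⟨w, l, hl.1, rfl⟩)
    · exact actAt_notMem_overlap hz w hl.2 h
  have htotal := HasSum.add_disjoint (f := fun μ : E n => g (z + μ)) hd2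
    (HasSum.add_disjoint (f := fun μ : E n => g (z + μ)) hd1 hgap hoverlap) hrest
  rw [← weightLattice_eq hz, zero_add, ← mul_add, ← hsplit] at htotal
  exact htotal
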